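/- Let $\{S_n\}_{n\ge 0}$ be a simple symmetric random walk on $\mathbb{Z}$ with $S_0=0$, defined on a probability space $(\Omega,\mathscr{F},\mathbb{P})$; that is, the increments $S_n-S_{n-1}$, $n\ge 1$, are i.i.d. and equal to $1$ or $-1$ with probability $\tfrac12$ each. For $y\in\mathbb{Z}$ and $n\ge 1$ let $$L(y,n):=\#\{0<k\le n: S_{k-1}=y,\ S_k=y+1\}+\#\{0<k\le n: S_{k-1}=y+1,\ S_k=y\}$$ be the number of times the walk crosses the edge $\langle y,y+1\rangle$ up to time $n$, and let $\alpha(n):=\#\{x\in\mathbb{Z}: L(x,n)=1\}$ be the number of edges crossed exactly once (the rarely visited edges) up to time $n$. Then there is a deterministic constant $C\in(0,\infty)$, the same for every such walk, such that $$\mathbb{P}\left(\limsup_{n\to\infty}\frac{\alpha(n)}{(\log n)^2}=C\right)=1 .$$ Moreover, $C\in\left[\tfrac1{128},\tfrac12\right]$. -/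

import Mathlib

open MeasureTheory ProbabilityTheory

namespace RarelyVisited

/-- `S` is a simple symmetric random walk on `ℤ` started at `0`: its increments are i.i.d.
and equal to `1` or `-1` with probability `1/2` each. -/
structure IsSimpleSymmetricRandomWalk {Ω : Type*} [MeasurableSpace Ω] (P : Measure Ω)
    (S : ℕ → Ω → ℤ) : Prop where
  measurable : ∀ n, Measurable (S n)
  start : ∀ᵐ ω ∂P, S 0 ω = 0
  indep : iIndepFun (fun (n : ℕ) (ω : Ω) => S (n + 1) ω - S n ω) P
  step_up : ∀ n, P {ω | S (n + 1) ω - S n ω = 1} = 1 / 2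
  step_down : ∀ n, P {ω | S (n + 1) ω - S n ω = -1} = 1 / 2

/-- Number of upcrossings of `y` (steps from `y - 1` to `y`) by the path `s` up to time `n`. -/
def upcrossings (s : ℕ → ℤ) (y : ℤ) (n : ℕ) : ℕ :=
  ((Finset.Ioc 0 n).filter (fun k => s k = y ∧ s (k - 1) = y - 1)).card

/-- Number of downcrossings of `y` (steps from `y + 1` to `y`) by the path `s` up to time `n`. -/
def downcrossings (s : ℕ → ℤ) (y : ℤ) (n : ℕ) : ℕ :=
  ((Finset.Ioc 0 n).filter (fun k => s k = y ∧ s (k - 1) = y + 1)).card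

/-- Number of visits of the edge between `y` and `y + 1` by the path `s` up to time `n`. -/
def edgeVisits (s : ℕ → ℤ) (y : ℤ) (n : ℕ) : ℕ :=
  upcrossings s (y + 1) n + downcrossings s y n

/-- The edges visited exactly once by the path `s` up to time `n`; the edge between `x` and
`x + 1` is represented by its left endpoint `x`. -/
def rarelyVisitedEdges (s : ℕ → ℤ) (n : ℕ) : Set ℤ :=
  {x | edgeVisits s x n = 1}

/-- The number of edges visited exactly once by the path `s` up to time `n`. -/
noncomputable def numRarelyVisitedEdges (s : ℕ → ℤ) (n : ℕ) : ℕ :=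
  (rarelyVisitedEdges s n).ncard

/-- There are only finitely many such edges, so `Set.ncard` above is the true cardinality. -/
theorem finite_rarelyVisitedEdges (s : ℕ → ℤ) (n : ℕ) : (rarelyVisitedEdges s n).Finite := by
  refine (((Finset.Ioc 0 n).image s ∪
    (Finset.Ioc 0 n).image (fun k => s k - 1)).finite_toSet).subset ?_
  intro x hx
  have hx' : upcrossings s (x + 1) n + downcrossings s x n = 1 := hx
  have h : upcrossings s (x + 1) n ≠ 0 ∨ downcrossings s x n ≠ 0 := by omega
  simp only [Finset.coe_union, Finset.coe_image, Set.mem_union, Set.mem_image, Finset.mem_coe]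
  rcases h with h | h
  · obtain ⟨k, hk⟩ := Finset.card_ne_zero.mp h
    rw [Finset.mem_filter] at hk
    exact Or.inr ⟨k, hk.1, by omega⟩
  · obtain ⟨k, hk⟩ := Finset.card_ne_zero.mp h
    rw [Finset.mem_filter] at hk
    exact Or.inl ⟨k, hk.1, hk.2.1⟩

end RarelyVisited

/-! An edge crossed exactly once separates the start of the path from its end, so all such edges are
crossed in the same direction. Up to reflection they correspond to cut times: times `k` at which the
path reaches a strict maximum and never goes below it afterwards. Cutting at these times factors a
path into a word ending at a strict maximum, irreducible bridges, and a nonnegative path. The number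
of cut times thus has a renewal structure.

The weight `x ^ length` with `x = ρ / (1 + ρ ^ 2)` describes a walk that survives each step with
probability `2 * x` and reaches height `h` with probability `ρ ^ h`. Gambler's ruin gives mass `ρ ^
h / ∑ i ≤ h, ρ ^ (2 * i)` to bridges of height `h`, close to `1 / (h + 1)` for `ρ` near 1. Hence all
bridges together have mass `U` of order `log (1 / (1 - ρ))`, and the renewal equation `U = 1 + F *
U` gives irreducible bridges the mass `F = 1 - 1 / U`.

Upper bound: with `1 - ρ = 1 / m` and `m` of order `√N`, having more than `K` cut times before time
`N` costs about `m ^ 2 * exp (-K / log m)`. For `K = c * (log N) ^ 2` this is about `N ^ (1 - 2 *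
c)`, summable along `N = 4 ^ j` when `c > 1 / 2` (`coinSeq_many_rarelyVisited_le`, then
Borel–Cantelli).

Lower bound: `K` irreducible bridges in a row, padded to end at a fixed height `M`, are attempted
repeatedly at successive first passages. If being killed during an attempt is no likelier than
success, some attempt succeeds with probability near `1 / 2` (`exists_third_le_mass_retries`). A
polynomial time horizon then yields order `(log n) ^ 2` cut times with probability at least `1 / 6`
(`le_coinSeq_many_cutTimes_log`), hence infinitely often with positive probability.

Deleting the first step changes the count by at most one, so the limsup is shift invariant and
Kolmogorov's zero-one law makes it constant. The law of the steps is the coin tossing measure, so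
the constant is the same for every walk. -/

namespace RarelyVisited

open Filter Topology
open scoped ENNReal


/-! ### Words of up and down steps -/

/-- The increment encoded by a letter: `true` is a step up and `false` a step down. -/
def stepValue (b : Bool) : ℤ := if b then 1 else -1

@[simp] theorem stepValue_true : stepValue true = 1 := rfl
@[simp] theorem stepValue_false : stepValue false = -1 := rfl

theorem stepValue_not (b : Bool) : stepValue (!b) = -stepValue b := by cases b <;> rfl

/-- The displacement of a word. -/
def height (w : List Bool) : ℤ := (w.map stepValue).sum

@[simp] theorem height_nil : height [] = 0 := rfl

@[simp] theorem height_cons (b : Bool) (w : List Bool) :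
    height (b :: w) = stepValue b + height w := by simp [height]

@[simp] theorem height_append (u v : List Bool) : height (u ++ v) = height u + height v := by
  simp [height]

/-- The path of the word never goes below its starting point. -/
def NonnegPath (w : List Bool) : Prop := ∀ p q, w = p ++ q → 0 ≤ height p

/-- The path of the word ends at a point strictly above all previous points. -/
def StrictMax (w : List Bool) : Prop := ∀ p q, w = p ++ q → q ≠ [] → 0 < height q

theorem NonnegPath.nil : NonnegPath [] := by
  intro p q h
  simp [(List.append_eq_nil_iff.mp h.symm).1]

theorem StrictMax.nil : StrictMax [] := by
  intro p q h hq
  exact absurd (List.append_eq_nil_iff.mp h.symm).2 hq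

theorem NonnegPath.height_nonneg {w : List Bool} (h : NonnegPath w) : 0 ≤ height w :=
  h w [] (by simp)

theorem StrictMax.height_pos {w : List Bool} (h : StrictMax w) (hw : w ≠ []) : 0 < height w :=
  h [] w rfl hw

theorem StrictMax.height_nonneg {w : List Bool} (h : StrictMax w) : 0 ≤ height w := by
  rcases eq_or_ne w [] with rfl | hw
  · simp
  · exact (h.height_pos hw).le

theorem StrictMax.eq_nil {w : List Bool} (h : StrictMax w) (h0 : height w = 0) : w = [] := by
  by_contra hw
  have := h.height_pos hw
  omega

theorem NonnegPath.of_append_left {u v : List Bool} (h : NonnegPath (u ++ v)) : NonnegPath u := by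
  rintro p q rfl
  exact h p (q ++ v) (by simp)

theorem StrictMax.of_append_right {u v : List Bool} (h : StrictMax (u ++ v)) : StrictMax v := by
  rintro p q rfl hq
  exact h (u ++ p) q (by simp) hq

theorem NonnegPath.append {u v : List Bool} (hu : NonnegPath u) (hv : NonnegPath v) :
    NonnegPath (u ++ v) := by
  intro p q h
  rcases List.append_eq_append_iff.mp h with ⟨a, rfl, h2⟩ | ⟨a, h1, -⟩
  · have := hv a q h2
    have := hu.height_nonneg
    simp; omega
  · exact hu p a h1

theorem StrictMax.append {u v : List Bool} (hu : StrictMax u) (hv : StrictMax v) :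
    StrictMax (u ++ v) := by
  intro p q h hq
  rcases List.append_eq_append_iff.mp h with ⟨a, h1, h2⟩ | ⟨a, h1, h2⟩
  · exact hv a q h2 hq
  · subst h2
    have h3 := hv.height_nonneg
    rcases eq_or_ne a [] with rfl | ha
    · simpa using hv.height_pos (by simpa using hq)
    · have := hu p a h1 ha
      simp; omega

theorem StrictMax.height_lt {u v : List Bool} (h : StrictMax (u ++ v)) (hv : v ≠ []) :
    height u < height (u ++ v) := by
  have := h u v rfl hv
  simp; omega

/-! ### Bridges and uniqueness of factorization. -/

/-- Words whose path stays between its starting point and its end point, the latter being reached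
only at the end. -/
def IsBridge (w : List Bool) : Prop := NonnegPath w ∧ StrictMax w

/-- Bridges that are not a concatenation of two nonempty bridges. -/
def IsIrreducible (w : List Bool) : Prop :=
  IsBridge w ∧ w ≠ [] ∧ ∀ a b, w = a ++ b → IsBridge a → IsBridge b → a = [] ∨ b = []

theorem IsBridge.nil : IsBridge [] := ⟨NonnegPath.nil, StrictMax.nil⟩

theorem IsBridge.append {u v : List Bool} (hu : IsBridge u) (hv : IsBridge v) :
    IsBridge (u ++ v) := ⟨hu.1.append hv.1, hu.2.append hv.2⟩

/-- If one factor extends the other by `c`, then `c` is nonnegative as a prefix of a nonnegative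
path and ends at a strict maximum as a suffix of a bridge. So `c` is a bridge, and irreducibility
forces it to be empty. -/
theorem irreducible_append_inj {a a' b b' : List Bool} (ha : IsIrreducible a)
    (ha' : IsIrreducible a') (hb : NonnegPath b) (hb' : NonnegPath b')
    (h : a ++ b = a' ++ b') : a = a' ∧ b = b' := by
  have key : ∀ {a a' b b' : List Bool}, IsIrreducible a → IsIrreducible a' → NonnegPath b →
      (∃ c, a' = a ++ c ∧ b = c ++ b') → a = a' ∧ b = b' := by
    rintro a a' b b' ha ha' hb ⟨c, rfl, rfl⟩
    rcases ha'.2.2 a c rfl ha.1 ⟨hb.of_append_left, ha'.1.2.of_append_right⟩ with h | h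
    · exact absurd h ha.2.1
    · simp [h]
  rcases List.append_eq_append_iff.mp h with ⟨c, h1, h2⟩ | ⟨c, h1, h2⟩
  · exact key ha ha' hb ⟨c, h1, h2⟩
  · obtain ⟨h3, h4⟩ := key ha' ha hb' ⟨c, h1, h2⟩
    exact ⟨h3.symm, h4.symm⟩

theorem append_irreducible_inj {a a' b b' : List Bool} (ha : IsIrreducible a)
    (ha' : IsIrreducible a') (hb : StrictMax b) (hb' : StrictMax b')
    (h : b ++ a = b' ++ a') : b = b' ∧ a = a' := by
  have key : ∀ {a a' b b' : List Bool}, IsIrreducible a → IsIrreducible a' → StrictMax b' →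
      (∃ c, b' = b ++ c ∧ a = c ++ a') → b = b' ∧ a = a' := by
    rintro a a' b b' ha ha' hb ⟨c, rfl, rfl⟩
    rcases ha.2.2 c a' rfl ⟨ha.1.1.of_append_left, hb.of_append_right⟩ ha'.1 with h | h
    · simp [h]
    · exact absurd h ha'.2.1
  rcases List.append_eq_append_iff.mp h with ⟨c, h1, h2⟩ | ⟨c, h1, h2⟩
  · exact key ha ha' hb' ⟨c, h1, h2⟩
  · obtain ⟨h3, h4⟩ := key ha' ha hb ⟨c, h1, h2⟩
    exact ⟨h3.symm, h4.symm⟩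

/-- Words ending at a strict maximum form a prefix code at every fixed height. -/
theorem strictMax_append_inj {a a' b b' : List Bool} (ha : StrictMax a) (ha' : StrictMax a')
    (hh : height a = height a') (h : a ++ b = a' ++ b') : a = a' ∧ b = b' := by
  rcases List.append_eq_append_iff.mp h with ⟨c, rfl, rfl⟩ | ⟨c, rfl, rfl⟩
  · rcases eq_or_ne c [] with rfl | hc
    · simp
    · have := ha'.height_lt hc
      omega
  · rcases eq_or_ne c [] with rfl | hc
    · simp
    · have := ha.height_lt hc
      omega

/-! ### Cut times -/

noncomputable instance (w : List Bool) : Decidable (StrictMax w) := Classical.propDecidable _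
noncomputable instance (w : List Bool) : Decidable (NonnegPath w) := Classical.propDecidable _

/-- The times at which the path steps over an edge for the first and the last time, upwards. -/
noncomputable def cutTimes (w : List Bool) : Finset ℕ :=
  (Finset.Ioc 0 w.length).filter fun k => StrictMax (w.take k) ∧ NonnegPath (w.drop k)

theorem mem_cutTimes {w : List Bool} {k : ℕ} :
    k ∈ cutTimes w ↔ (0 < k ∧ k ≤ w.length) ∧ StrictMax (w.take k) ∧ NonnegPath (w.drop k) := by
  rw [cutTimes, Finset.mem_filter, Finset.mem_Ioc]

theorem card_cutTimes_le (w : List Bool) : (cutTimes w).card ≤ w.length :=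
  (Finset.card_filter_le _ _).trans (by simp)

theorem mem_cutTimes_append {w u v : List Bool} (h : w = u ++ v) (hu : u ≠ []) (hu' : StrictMax u)
    (hv : NonnegPath v) : u.length ∈ cutTimes w := by
  subst h
  rw [mem_cutTimes]
  refine ⟨⟨List.length_pos_iff.mpr hu, by simp⟩, ?_, ?_⟩
  · simpa using hu'
  · simpa using hv

theorem card_cutTimes_append_left {a g : List Bool} (ha : StrictMax a) :
    (cutTimes g).card ≤ (cutTimes (a ++ g)).card := by
  refine Finset.card_le_card_of_injOn (fun k => a.length + k) ?_ (fun x _ y _ h => by simpa using h)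
  intro k hk
  rw [Finset.mem_coe, mem_cutTimes] at hk ⊢
  obtain ⟨⟨h1, h2⟩, h3, h4⟩ := hk
  dsimp only
  refine ⟨⟨by omega, by simp; omega⟩, ?_, ?_⟩
  · rw [List.take_length_add_append]
    exact ha.append h3
  · rw [List.drop_length_add_append]
    exact h4

theorem card_cutTimes_append_right {v t : List Bool} (hv : StrictMax v) (ht : IsBridge t)
    (ht0 : t ≠ []) : (cutTimes v).card + 1 ≤ (cutTimes (v ++ t)).card := by
  have hpos := List.length_pos_iff.mpr ht0
  have hnot : (v ++ t).length ∉ cutTimes v := by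
    rw [mem_cutTimes]
    simp only [List.length_append]
    omega
  rw [← Finset.card_insert_of_notMem hnot]
  refine Finset.card_le_card fun k hk => ?_
  rcases Finset.mem_insert.mp hk with rfl | hk
  · exact mem_cutTimes_append (by simp) (by simp [ht0]) (hv.append ht.2) NonnegPath.nil
  · rw [mem_cutTimes] at hk ⊢
    obtain ⟨⟨h1, h2⟩, h3, h4⟩ := hk
    refine ⟨⟨h1, by simp; omega⟩, ?_, ?_⟩
    · rwa [List.take_append_of_le_length h2]
    · rw [List.drop_append_of_le_length h2]
      exact h4.append ht.1

/-- The split is at the earliest cut time. Its minimality is recorded as the absence of a cut inside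
`u`, which turns into irreducibility once `u` is a bridge. Later cut times of `w` shift to cut times
of `v`, so only one is lost. -/
theorem exists_first_cut {w : List Bool} (h : 0 < (cutTimes w).card) :
    ∃ u v, w = u ++ v ∧ u ≠ [] ∧ StrictMax u ∧ NonnegPath v ∧
      (∀ a b, u = a ++ b → a ≠ [] → b ≠ [] → StrictMax a → ¬ NonnegPath (b ++ v)) ∧
      (cutTimes w).card ≤ (cutTimes v).card + 1 := by
  have hne := Finset.card_pos.mp h
  set k := (cutTimes w).min' hne with hk
  have hmem : k ∈ cutTimes w := Finset.min'_mem _ _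
  obtain ⟨⟨h1, h2⟩, h3, h4⟩ := mem_cutTimes.mp hmem
  have hlen : (w.take k).length = k := by simp [h2]
  refine ⟨w.take k, w.drop k, by simp, ?_, h3, h4, ?_, ?_⟩
  · intro h0
    rw [h0] at hlen
    simp at hlen
    omega
  · intro a b hab ha hb hsa hnb
    have : a.length ∈ cutTimes w := by
      refine mem_cutTimes_append (v := b ++ w.drop k) ?_ ha hsa hnb
      rw [← List.append_assoc, ← hab, List.take_append_drop]
    have h5 := Finset.min'_le _ _ this
    have h6 : (w.take k).length = a.length + b.length := by rw [hab]; simp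
    have := List.length_pos_iff.mpr hb
    omega
  · rw [← Finset.card_erase_add_one hmem]
    refine Nat.add_le_add_right ?_ 1
    have hlt : ∀ j ∈ (cutTimes w).erase k, k < j := fun j hj =>
      lt_of_le_of_ne (Finset.min'_le _ _ (Finset.mem_of_mem_erase hj)) (Finset.ne_of_mem_erase hj).symm
    refine Finset.card_le_card_of_injOn (fun j => j - k) ?_ ?_
    · intro j hj
      have hkj := hlt j hj
      rw [Finset.mem_coe] at hj ⊢
      obtain ⟨⟨g1, g2⟩, g3, g4⟩ := mem_cutTimes.mp (Finset.mem_of_mem_erase hj)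
      rw [mem_cutTimes]
      dsimp only
      refine ⟨⟨by omega, by simp; omega⟩, ?_, ?_⟩
      · have : w.take j = w.take k ++ (w.drop k).take (j - k) := by
          rw [← List.take_add]
          congr 1
          omega
        rw [this] at g3
        exact g3.of_append_right
      · rw [List.drop_drop]
        rwa [show k + (j - k) = j by omega]
    · intro i hi j hj hij
      have := hlt i hi
      have := hlt j hj
      simp only at hij
      omega

/-- Concatenations of `n` irreducible bridges. -/
def irreducibleProducts : ℕ → Set (List Bool)
  | 0 => {[]}
  | n + 1 => Set.image2 (· ++ ·) {w | IsIrreducible w} (irreducibleProducts n)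

/-- Peel off the piece before the first cut time. It is a bridge because `q` is nonnegative, and
irreducible because a splitting into two bridges would produce an earlier cut time. -/
theorem mem_irreducibleProducts_append {n : ℕ} {q : List Bool} (hq : NonnegPath q)
    (hn : n ≤ (cutTimes q).card) :
    q ∈ Set.image2 (· ++ ·) (irreducibleProducts n) {w | NonnegPath w} := by
  induction n generalizing q with
  | zero => exact ⟨[], rfl, q, hq, rfl⟩
  | succ n ih =>
    obtain ⟨u, v, rfl, hu0, hu, hv, hirr, hcard⟩ := exists_first_cut (w := q) (by omega)
    obtain ⟨a, ha, b, hb, rfl⟩ := ih hv (by omega)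
    refine ⟨u ++ a, ⟨u, ⟨⟨hq.of_append_left, hu⟩, hu0, ?_⟩, a, ha, rfl⟩, b, hb, by simp⟩
    intro c d hcd hc hd
    by_contra! hne
    exact hirr c d hcd hne.1 hne.2 hc.2 (hd.1.append hv)

theorem mem_of_lt_card_cutTimes {n : ℕ} {w : List Bool} (hn : n < (cutTimes w).card) :
    w ∈ Set.image2 (· ++ ·) {w | StrictMax w}
      (Set.image2 (· ++ ·) (irreducibleProducts n) {w | NonnegPath w}) := by
  obtain ⟨u, v, rfl, -, hu, hv, -, hcard⟩ := exists_first_cut (w := w) (by omega)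
  exact ⟨u, hu, v, mem_irreducibleProducts_append hv (by omega), rfl⟩


/-! ### Generating functions of sets of words -/

/-- The generating function of a set of words, evaluated at `x`. -/
noncomputable def mass (x : ℝ≥0∞) (L : Set (List Bool)) : ℝ≥0∞ :=
  ∑' w : L, x ^ (w : List Bool).length

theorem mass_eq_indicator (x : ℝ≥0∞) (L : Set (List Bool)) :
    mass x L = ∑' w, L.indicator (fun w => x ^ w.length) w :=
  tsum_subtype L (fun w : List Bool => x ^ w.length)

theorem mass_mono {x : ℝ≥0∞} {L L' : Set (List Bool)} (h : L ⊆ L') : mass x L ≤ mass x L' :=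
  ENNReal.tsum_mono_subtype (fun w : List Bool => x ^ w.length) h

@[simp] theorem mass_empty (x : ℝ≥0∞) : mass x ∅ = 0 := by simp [mass]

@[simp] theorem mass_singleton_nil (x : ℝ≥0∞) : mass x {[]} = 1 := by
  rw [mass, tsum_singleton ([] : List Bool) (fun w : List Bool => x ^ w.length)]
  simp

theorem mass_union {x : ℝ≥0∞} {A B : Set (List Bool)} (h : Disjoint A B) :
    mass x (A ∪ B) = mass x A + mass x B :=
  ENNReal.summable.tsum_union_disjoint (f := fun w : List Bool => x ^ w.length) h ENNReal.summable

theorem mass_iUnion_le {ι : Type*} (x : ℝ≥0∞) (A : ι → Set (List Bool)) :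
    mass x (⋃ i, A i) ≤ ∑' i, mass x (A i) :=
  ENNReal.tsum_iUnion_le_tsum (fun w : List Bool => x ^ w.length) A

theorem sum_mass_le {ι : Type*} {x : ℝ≥0∞} (s : Finset ι) {A : ι → Set (List Bool)}
    {C : Set (List Bool)} (hd : (s : Set ι).PairwiseDisjoint A) (hC : ∀ i ∈ s, A i ⊆ C) :
    ∑ i ∈ s, mass x (A i) ≤ mass x C := by
  classical
  induction s using Finset.induction_on generalizing C with
  | empty => simp
  | insert i s hi ih =>
    rw [Finset.sum_insert hi]
    have h1 : ∑ j ∈ s, mass x (A j) ≤ mass x (C \ A i) := by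
      refine ih (hd.subset (by simp)) fun j hj => ?_
      refine Set.subset_sdiff.mpr ⟨hC j (by simp [hj]), ?_⟩
      exact hd (by simp [hj]) (by simp) (by rintro rfl; exact hi hj)
    calc mass x (A i) + ∑ j ∈ s, mass x (A j) ≤ mass x (A i) + mass x (C \ A i) := by gcongr
      _ = mass x C := by
        rw [← mass_union Set.disjoint_sdiff_right, Set.union_sdiff_cancel (hC i (by simp))]

theorem mass_mul_mass (x : ℝ≥0∞) (A B : Set (List Bool)) :
    mass x A * mass x B =
      ∑' p : A × B, x ^ ((p.1 : List Bool) ++ (p.2 : List Bool)).length := by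
  rw [ENNReal.tsum_prod', mass, mass, ← ENNReal.tsum_mul_right]
  refine tsum_congr fun a => ?_
  rw [← ENNReal.tsum_mul_left]
  refine tsum_congr fun b => ?_
  rw [List.length_append, pow_add]

/-- Unique factorization makes concatenation injective on pairs, which gives the lower bound on the
mass of products. The upper bound `mass_image2_le` needs only surjectivity. -/
theorem mass_mul_le {x : ℝ≥0∞} {A B C : Set (List Bool)} (hC : ∀ a ∈ A, ∀ b ∈ B, a ++ b ∈ C)
    (hinj : ∀ a ∈ A, ∀ a' ∈ A, ∀ b ∈ B, ∀ b' ∈ B, a ++ b = a' ++ b' → a = a' ∧ b = b') :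
    mass x A * mass x B ≤ mass x C := by
  rw [mass_mul_mass]
  let g : A × B → C := fun p => ⟨(p.1 : List Bool) ++ (p.2 : List Bool), hC _ p.1.2 _ p.2.2⟩
  have hg : Function.Injective g := by
    rintro ⟨a, b⟩ ⟨a', b'⟩ h
    obtain ⟨h1, h2⟩ := hinj a a.2 a' a'.2 b b.2 b' b'.2 (congrArg Subtype.val h)
    exact Prod.ext (Subtype.ext h1) (Subtype.ext h2)
  exact ENNReal.tsum_comp_le_tsum_of_injective hg (fun w : C => x ^ (w : List Bool).length)

theorem mass_image2_le (x : ℝ≥0∞) (A B : Set (List Bool)) :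
    mass x (Set.image2 (· ++ ·) A B) ≤ mass x A * mass x B := by
  rw [mass_mul_mass]
  let g : A × B → Set.image2 (· ++ ·) A B := fun p => ⟨_, Set.mem_image2_of_mem p.1.2 p.2.2⟩
  have hg : Function.Surjective g := by
    rintro ⟨_, a, ha, b, hb, rfl⟩
    exact ⟨(⟨a, ha⟩, ⟨b, hb⟩), rfl⟩
  exact ENNReal.tsum_le_tsum_comp_of_surjective hg
    (fun w : Set.image2 (· ++ ·) A B => x ^ (w : List Bool).length)

theorem tsum_list_bool (f : List Bool → ℝ≥0∞) :
    ∑' w, f w = f [] + (∑' w, f (true :: w) + ∑' w, f (false :: w)) := by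
  let e : Unit ⊕ (List Bool ⊕ List Bool) ≃ List Bool :=
    { toFun := Sum.elim (fun _ => []) (Sum.elim (List.cons true) (List.cons false))
      invFun := fun w => match w with
        | [] => Sum.inl ()
        | true :: w => Sum.inr (Sum.inl w)
        | false :: w => Sum.inr (Sum.inr w)
      left_inv := by rintro (_ | _ | _) <;> rfl
      right_inv := by rintro (_ | ⟨_ | _, _⟩) <;> rfl }
  rw [← e.tsum_eq, ENNReal.summable.tsum_sum ENNReal.summable,
    ENNReal.summable.tsum_sum ENNReal.summable]
  simp [e]

open Classical in
theorem mass_cons (x : ℝ≥0∞) (L : Set (List Bool)) :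
    mass x L = (if [] ∈ L then 1 else 0) +
      (x * mass x {w | true :: w ∈ L} + x * mass x {w | false :: w ∈ L}) := by
  have h : ∀ b : Bool, ∑' w, L.indicator (fun w => x ^ w.length) (b :: w) =
      x * mass x {w | b :: w ∈ L} := by
    intro b
    rw [mass_eq_indicator, ← ENNReal.tsum_mul_left]
    refine tsum_congr fun w => ?_
    by_cases hw : b :: w ∈ L
    · rw [Set.indicator_of_mem hw, Set.indicator_of_mem (show w ∈ {w | b :: w ∈ L} from hw)]
      simp [pow_succ']
    · rw [Set.indicator_of_notMem hw,
        Set.indicator_of_notMem (show w ∉ {w | b :: w ∈ L} from hw), mul_zero]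
  rw [mass_eq_indicator, tsum_list_bool, h, h, Set.indicator_apply]
  simp

/-- The number `T = 1 / (1 - 2 * x)` solves `1 + 2 * x * T = T`, so the first-letter recursion
propagates the bound `T` through the languages truncated by length. -/
theorem mass_lt_top {x : ℝ≥0∞} (hx : x < 2⁻¹) (L : Set (List Bool)) : mass x L < ∞ := by
  have h2x : 2 * x < 1 := by
    have := ENNReal.mul_lt_mul_right (a := 2) (by simp) (by simp) hx
    rwa [ENNReal.mul_inv_cancel (by simp) (by simp)] at this
  set T : ℝ≥0∞ := (1 - 2 * x)⁻¹ with hT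
  have hTtop : T ≠ ∞ := by
    rw [hT, Ne, ENNReal.inv_eq_top]
    exact (tsub_pos_of_lt h2x).ne'
  have hfix : 1 + 2 * x * T = T := by
    have h0 : 1 - 2 * x ≠ 0 := (tsub_pos_of_lt h2x).ne'
    have h1 : (1 - 2 * x) * T = 1 :=
      ENNReal.mul_inv_cancel h0 (ENNReal.sub_ne_top ENNReal.one_ne_top)
    calc 1 + 2 * x * T = (1 - 2 * x) * T + 2 * x * T := by rw [h1]
      _ = (1 - 2 * x + 2 * x) * T := by rw [add_mul]
      _ = T := by rw [tsub_add_cancel_of_le h2x.le, one_mul]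
  have hbound : ∀ n, mass x {w | w.length < n} ≤ T := by
    intro n
    induction n with
    | zero => simp
    | succ n ih =>
      rw [mass_cons]
      simp only [Set.mem_ofPred_eq, List.length_nil, Nat.zero_lt_succ, if_true, List.length_cons,
        Nat.add_lt_add_iff_right]
      calc _ ≤ 1 + (x * T + x * T) := by gcongr
        _ = 1 + 2 * x * T := by ring
        _ = T := hfix
  refine lt_of_le_of_lt (b := T) ?_ (lt_top_iff_ne_top.mpr hTtop)
  rw [mass, ENNReal.tsum_eq_iSup_sum]
  refine iSup_le fun s => ?_
  obtain ⟨n, hn⟩ : ∃ n, ∀ w ∈ s, (w : List Bool).length < n :=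
    ⟨s.sup (fun w => (w : List Bool).length) + 1, fun w hw =>
      Nat.lt_succ_of_le (Finset.le_sup (f := fun w : L => (w : List Bool).length) hw)⟩
  refine le_trans ?_ (hbound n)
  rw [mass_eq_indicator]
  refine le_trans (Finset.sum_map s (Function.Embedding.subtype _)
    (fun w : List Bool => x ^ w.length)).ge ?_
  refine le_trans (Finset.sum_le_sum fun w hw => ?_) (ENNReal.sum_le_tsum _)
  obtain ⟨v, hv, rfl⟩ := Finset.mem_map.mp hw
  rw [Set.indicator_of_mem]
  exact hn v hv

/-- The maximum principle for the killed walk. -/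
theorem eq_zero_of_abs_le_neighbours {x B : ℝ} (hx0 : 0 ≤ x) (hx : x < 1 / 2) {e : ℤ → ℝ}
    (hB : ∀ k, |e k| ≤ B) (he : ∀ k, |e k| ≤ x * (|e (k + 1)| + |e (k - 1)|)) (k : ℤ) :
    e k = 0 := by
  have h : ∀ n : ℕ, ∀ k, |e k| ≤ (2 * x) ^ n * B := by
    intro n
    induction n with
    | zero => simpa using hB
    | succ n ih =>
      intro k
      calc |e k| ≤ x * (|e (k + 1)| + |e (k - 1)|) := he k
        _ ≤ x * ((2 * x) ^ n * B + (2 * x) ^ n * B) := by gcongr <;> apply ih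
        _ = (2 * x) ^ (n + 1) * B := by ring
  have hlim : Tendsto (fun n : ℕ => (2 * x) ^ n * B) atTop (𝓝 (0 * B)) :=
    (tendsto_pow_atTop_nhds_zero_of_lt_one (by linarith) (by linarith)).mul_const B
  rw [zero_mul] at hlim
  exact abs_eq_zero.mp (le_antisymm (ge_of_tendsto' hlim fun n => h n k) (abs_nonneg _))

theorem ofReal_lt_half {x : ℝ} (hx : x < 1 / 2) : ENNReal.ofReal x < 2⁻¹ := by
  have h : (2⁻¹ : ℝ≥0∞) = ENNReal.ofReal (1 / 2) := by
    rw [one_div, ENNReal.ofReal_inv_of_pos (by norm_num)]; simp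
  rw [h]
  exact (ENNReal.ofReal_lt_ofReal_iff (by norm_num)).mpr hx

open Classical in
/-- Generating functions of languages recognized by the position of the walk are determined by a
one-step recursion. -/
theorem mass_eq_of_recursion {x B : ℝ} (hx0 : 0 ≤ x) (hx : x < 1 / 2) (L : ℤ → Set (List Bool))
    (φ : ℤ → ℝ) (hφ : ∀ k, 0 ≤ φ k) (hB : ∀ k, φ k ≤ B)
    (h : ∀ k, (L k = ∅ ∧ φ k = 0) ∨ (L k = {[]} ∧ φ k = 1) ∨
      ({w | true :: w ∈ L k} = L (k + 1) ∧ {w | false :: w ∈ L k} = L (k - 1) ∧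
        φ k = (if [] ∈ L k then 1 else 0) + x * (φ (k + 1) + φ (k - 1)))) (k : ℤ) :
    mass (ENNReal.ofReal x) (L k) = ENNReal.ofReal (φ k) := by
  have hfin : ∀ L, mass (ENNReal.ofReal x) L < ∞ := mass_lt_top (ofReal_lt_half hx)
  set m : ℤ → ℝ := fun k => (mass (ENNReal.ofReal x) (L k)).toReal with hm
  have hmB : ∀ k, m k ≤ (mass (ENNReal.ofReal x) Set.univ).toReal := fun k =>
    ENNReal.toReal_mono (hfin _).ne (mass_mono (Set.subset_univ _))
  have hm0 : ∀ k, 0 ≤ m k := fun k => ENNReal.toReal_nonneg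
  have key : ∀ k, m k - φ k = 0 := by
    refine eq_zero_of_abs_le_neighbours (B := (mass (ENNReal.ofReal x) Set.univ).toReal + B)
      hx0 hx (fun k => ?_) (fun k => ?_)
    · rw [abs_le]
      constructor <;> linarith [hmB k, hm0 k, hB k, hφ k, hmB 0, hm0 0, hB 0, hφ 0]
    · rcases h k with ⟨h1, h2⟩ | ⟨h1, h2⟩ | ⟨h1, h2, h3⟩
      · simp only [hm, h1, h2]
        simp
        positivity
      · simp only [hm, h1, h2]
        simp
        positivity
      · have h4 : m k = (if [] ∈ L k then 1 else 0) + x * (m (k + 1) + m (k - 1)) := by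
          simp only [hm]
          rw [mass_cons, h1, h2, ENNReal.toReal_add, ENNReal.toReal_add, ENNReal.toReal_mul,
            ENNReal.toReal_mul, ENNReal.toReal_ofReal hx0, mul_add]
          · split_ifs <;> simp
          · exact ENNReal.mul_ne_top ENNReal.ofReal_ne_top (hfin _).ne
          · exact ENNReal.mul_ne_top ENNReal.ofReal_ne_top (hfin _).ne
          · split_ifs <;> simp
          · exact ENNReal.add_ne_top.mpr ⟨ENNReal.mul_ne_top ENNReal.ofReal_ne_top (hfin _).ne,
              ENNReal.mul_ne_top ENNReal.ofReal_ne_top (hfin _).ne⟩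
        have h5 : m k - φ k = x * ((m (k + 1) - φ (k + 1)) + (m (k - 1) - φ (k - 1))) := by
          rw [h4, h3]; ring
        rw [h5, abs_mul, abs_of_nonneg hx0]
        gcongr
        exact abs_add_le _ _
  rw [← sub_eq_zero.mp (key k), ENNReal.ofReal_toReal (hfin _).ne]


/-! ### The elementary generating functions -/

theorem strictMax_cons {b : Bool} {w : List Bool} :
    StrictMax (b :: w) ↔ StrictMax w ∧ 0 < height (b :: w) := by
  constructor
  · intro h
    exact ⟨StrictMax.of_append_right (u := [b]) h, h.height_pos (by simp)⟩
  · rintro ⟨h1, h2⟩ p q hpq hq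
    rcases p with _ | ⟨c, p⟩
    · rw [List.nil_append] at hpq
      rwa [← hpq]
    · exact h1 p q (List.cons.inj hpq).2 hq

/-- The path of the word started at `k` stays nonnegative. -/
def NonnegFrom (k : ℤ) (w : List Bool) : Prop := ∀ p q, w = p ++ q → 0 ≤ k + height p

theorem nonnegFrom_zero {w : List Bool} : NonnegFrom 0 w ↔ NonnegPath w := by
  simp [NonnegFrom, NonnegPath]

theorem nonnegFrom_nil {k : ℤ} : NonnegFrom k [] ↔ 0 ≤ k := by
  constructor
  · intro h
    simpa using h [] [] rfl
  · intro h p q hpq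
    rw [(List.append_eq_nil_iff.mp hpq.symm).1]
    simpa using h

theorem NonnegFrom.nonneg {k : ℤ} {w : List Bool} (h : NonnegFrom k w) : 0 ≤ k := by
  simpa using h [] w rfl

theorem nonnegFrom_cons {k : ℤ} {b : Bool} {w : List Bool} :
    NonnegFrom k (b :: w) ↔ 0 ≤ k ∧ NonnegFrom (k + stepValue b) w := by
  constructor
  · intro h
    refine ⟨h.nonneg, fun p q hpq => ?_⟩
    have := h (b :: p) q (by simp [hpq])
    simpa [add_assoc] using this
  · rintro ⟨h1, h2⟩ p q hpq
    rcases p with _ | ⟨c, p⟩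
    · simpa using h1
    · obtain ⟨rfl, h3⟩ := List.cons.inj hpq
      have := h2 p q h3
      simpa [add_assoc] using this

theorem div_one_add_sq_lt_half {ρ : ℝ} (h1 : ρ < 1) : ρ / (1 + ρ ^ 2) < 1 / 2 := by
  rw [div_lt_div_iff₀ (by positivity) (by norm_num)]
  nlinarith [sq_pos_of_pos (sub_pos.mpr h1)]

/-- The index `d` is the position relative to the target, so `-d` is the height still to climb. The
value `ρ ^ h` satisfies the recursion because `ρ = x * (1 + ρ ^ 2)`. -/
theorem mass_strictMax_height {ρ : ℝ} (h0 : 0 < ρ) (h1 : ρ < 1) (h : ℕ) :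
    mass (ENNReal.ofReal (ρ / (1 + ρ ^ 2))) {w | StrictMax w ∧ height w = h} =
      ENNReal.ofReal (ρ ^ h) := by
  have := mass_eq_of_recursion (x := ρ / (1 + ρ ^ 2)) (B := 1) (by positivity)
    (div_one_add_sq_lt_half h1) (fun d => {w | StrictMax w ∧ height w = -d})
    (fun d => if d ≤ 0 then ρ ^ (-d).toNat else 0) (fun d => by split_ifs <;> positivity)
    (fun d => by
      split_ifs
      · exact pow_le_one₀ h0.le h1.le
      · norm_num) (fun d => ?_) (-h : ℤ)
  · simpa using this
  · rcases lt_trichotomy d 0 with hd | rfl | hd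
    · right; right
      have hnil : [] ∉ {w | StrictMax w ∧ height w = -d} := by
        rintro ⟨-, h⟩
        simp at h
        omega
      refine ⟨Set.ext fun w => ?_, Set.ext fun w => ?_, ?_⟩
      · change (StrictMax _ ∧ _ = -d) ↔ StrictMax _ ∧ _ = -(d + 1)
        rw [strictMax_cons, height_cons, stepValue_true]
        exact ⟨fun h => ⟨h.1.1, by omega⟩, fun h => ⟨⟨h.1, by omega⟩, by omega⟩⟩
      · change (StrictMax _ ∧ _ = -d) ↔ StrictMax _ ∧ _ = -(d - 1)
        rw [strictMax_cons, height_cons, stepValue_false]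
        exact ⟨fun h => ⟨h.1.1, by omega⟩, fun h => ⟨⟨h.1, by omega⟩, by omega⟩⟩
      · rw [if_neg hnil]
        obtain ⟨n, rfl⟩ : ∃ n : ℕ, d = -(n + 1) := ⟨(-d - 1).toNat, by omega⟩
        have e1 : (-(-((n : ℤ) + 1) + 1)).toNat = n := by omega
        have e2 : (-(-((n : ℤ) + 1) - 1)).toNat = n + 2 := by omega
        have e3 : (-(-((n : ℤ) + 1))).toNat = n + 1 := by omega
        rw [e1, e2, e3, if_pos (by omega), if_pos (by omega), if_pos (by omega)]
        field_simp
        ring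
    · right; left
      refine ⟨Set.ext fun w => ⟨fun hw => hw.1.eq_nil (by simpa using hw.2), ?_⟩, by simp⟩
      rintro rfl
      exact ⟨StrictMax.nil, rfl⟩
    · left
      refine ⟨Set.eq_empty_iff_forall_notMem.mpr ?_, by simp [hd]⟩
      rintro w ⟨hw, hw2⟩
      have := hw.height_nonneg
      omega

/-- The constant `(1 + ρ ^ 2) / (1 - ρ) ^ 2` equals `1 / (1 - 2 * x)`, the mass of all words.
Subtracting its multiple by `ρ ^ (k + 1)` makes the solution vanish at `k = -1`. -/
theorem mass_nonnegPath {ρ : ℝ} (h0 : 0 < ρ) (h1 : ρ < 1) :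
    mass (ENNReal.ofReal (ρ / (1 + ρ ^ 2))) {w | NonnegPath w} =
      ENNReal.ofReal ((1 + ρ ^ 2) / (1 - ρ)) := by
  have hρ : 0 < 1 - ρ := by linarith
  have := mass_eq_of_recursion (x := ρ / (1 + ρ ^ 2)) (B := (1 + ρ ^ 2) / (1 - ρ) ^ 2)
    (by positivity) (div_one_add_sq_lt_half h1) (fun k => {w | NonnegFrom k w})
    (fun k => if 0 ≤ k then (1 + ρ ^ 2) / (1 - ρ) ^ 2 * (1 - ρ ^ (k + 1).toNat) else 0)
    (fun k => by
      have : ρ ^ (k + 1).toNat ≤ 1 := pow_le_one₀ h0.le h1.le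
      have : 0 ≤ 1 - ρ ^ (k + 1).toNat := by linarith
      split_ifs <;> positivity)
    (fun k => by
      split_ifs
      · refine mul_le_of_le_one_right (by positivity) ?_
        linarith [pow_pos h0 (k + 1).toNat]
      · positivity) (fun k => ?_) 0
  · simp only [nonnegFrom_zero] at this
    rw [this]
    congr 1
    norm_num
    field_simp
  · rcases lt_or_ge k 0 with hk | hk
    · left
      refine ⟨Set.eq_empty_iff_forall_notMem.mpr fun w hw => ?_, by simp [hk]⟩
      exact absurd (NonnegFrom.nonneg hw) (by omega)
    · right; right
      have hnil : [] ∈ {w | NonnegFrom k w} := nonnegFrom_nil.mpr hk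
      refine ⟨Set.ext fun w => ?_, Set.ext fun w => ?_, ?_⟩
      · change NonnegFrom _ _ ↔ NonnegFrom _ _
        rw [nonnegFrom_cons, stepValue_true]
        exact and_iff_right hk
      · change NonnegFrom _ _ ↔ NonnegFrom _ _
        rw [nonnegFrom_cons, stepValue_false]
        exact and_iff_right hk
      · rw [if_pos hnil, if_pos hk, if_pos (by omega)]
        obtain ⟨n, rfl⟩ : ∃ n : ℕ, k = n := ⟨k.toNat, by omega⟩
        have e1 : ((n : ℤ) + 1 + 1).toNat = n + 2 := by omega
        have e2 : ((n : ℤ) - 1 + 1).toNat = n := by omega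
        have e3 : ((n : ℤ) + 1).toNat = n + 1 := by omega
        rw [e1, e2, e3]
        have e4 : (if (0 : ℤ) ≤ n - 1 then (1 + ρ ^ 2) / (1 - ρ) ^ 2 * (1 - ρ ^ n) else 0) =
            (1 + ρ ^ 2) / (1 - ρ) ^ 2 * (1 - ρ ^ n) := by
          split_ifs with h
          · rfl
          · rw [show n = 0 by omega]; simp
        rw [e4]
        field_simp
        ring

/-- Gambler's ruin: among combinations of `ρ ^ k` and `ρ ^ (-k)`, the one used vanishes at `k = -1`
and equals 1 at `k = h`. -/
theorem mass_isBridge_height {ρ : ℝ} (h0 : 0 < ρ) (h1 : ρ < 1) (h : ℕ) :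
    mass (ENNReal.ofReal (ρ / (1 + ρ ^ 2))) {w | IsBridge w ∧ height w = h} =
      ENNReal.ofReal (ρ ^ h * (1 - ρ ^ 2) / (1 - ρ ^ (2 * h + 2))) := by
  have hpow : ∀ n : ℕ, 0 ≤ 1 - ρ ^ n := fun n => sub_nonneg.mpr (pow_le_one₀ h0.le h1.le)
  have hden : 0 < 1 - ρ ^ (2 * h + 2) :=
    sub_pos.mpr (pow_lt_one₀ h0.le h1 (by omega))
  have := mass_eq_of_recursion (x := ρ / (1 + ρ ^ 2)) (B := 1 / (1 - ρ ^ (2 * h + 2)))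
    (by positivity) (div_one_add_sq_lt_half h1)
    (fun k => {w | NonnegFrom k w ∧ StrictMax w ∧ k + height w = h})
    (fun k => if 0 ≤ k ∧ k ≤ h then
      ρ ^ (h - k).toNat * (1 - ρ ^ (2 * k.toNat + 2)) / (1 - ρ ^ (2 * h + 2)) else 0)
    (fun k => by
      have := hpow (2 * k.toNat + 2)
      split_ifs <;> positivity)
    (fun k => by
      split_ifs
      · gcongr
        refine mul_le_one₀ (pow_le_one₀ h0.le h1.le) (hpow _) ?_
        linarith [pow_pos h0 (2 * k.toNat + 2)]
      · positivity) (fun k => ?_) 0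
  · simp only [nonnegFrom_zero, zero_add, ← and_assoc] at this
    refine Eq.trans this ?_
    simp
  · have hout : ¬ (0 ≤ k ∧ k ≤ h) → {w | NonnegFrom k w ∧ StrictMax w ∧ k + height w = h} = ∅ := by
      intro hk
      refine Set.eq_empty_iff_forall_notMem.mpr ?_
      rintro w ⟨hw1, hw2, hw3⟩
      have := hw1.nonneg
      have := hw2.height_nonneg
      omega
    by_cases hk : 0 ≤ k ∧ k ≤ h
    · rcases hk.2.lt_or_eq with hk' | rfl
      · right; right
        have hnil : [] ∉ {w | NonnegFrom k w ∧ StrictMax w ∧ k + height w = h} := by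
          rintro ⟨-, -, h⟩
          simp at h
          omega
        refine ⟨Set.ext fun w => ?_, Set.ext fun w => ?_, ?_⟩
        · change (NonnegFrom _ _ ∧ StrictMax _ ∧ _ = _) ↔ (NonnegFrom _ _ ∧ StrictMax _ ∧ _ = _)
          rw [nonnegFrom_cons, strictMax_cons, height_cons, stepValue_true]
          exact ⟨fun h => ⟨h.1.2, h.2.1.1, by omega⟩,
            fun h => ⟨⟨hk.1, h.1⟩, ⟨h.2.1, by omega⟩, by omega⟩⟩
        · change (NonnegFrom _ _ ∧ StrictMax _ ∧ _ = _) ↔ (NonnegFrom _ _ ∧ StrictMax _ ∧ _ = _)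
          rw [nonnegFrom_cons, strictMax_cons, height_cons, stepValue_false]
          exact ⟨fun h => ⟨h.1.2, h.2.1.1, by omega⟩,
            fun h => ⟨⟨hk.1, h.1⟩, ⟨h.2.1, by omega⟩, by omega⟩⟩
        · rw [if_neg hnil, if_pos hk, if_pos ⟨by omega, by omega⟩]
          obtain ⟨n, rfl⟩ : ∃ n : ℕ, k = n := ⟨k.toNat, by omega⟩
          obtain ⟨m, rfl⟩ : ∃ m : ℕ, h = n + m + 1 := ⟨h - n - 1, by omega⟩
          have e1 : (((n + m + 1 : ℕ) : ℤ) - (n + 1)).toNat = m := by omega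
          have e2 : (((n + m + 1 : ℕ) : ℤ) - (n - 1)).toNat = m + 2 := by omega
          have e3 : (((n + m + 1 : ℕ) : ℤ) - n).toNat = m + 1 := by omega
          have e4 : 2 * ((n : ℤ) + 1).toNat + 2 = 2 * n + 4 := by omega
          have e5 : (if (0 : ℤ) ≤ n - 1 ∧ (n : ℤ) - 1 ≤ (n + m + 1 : ℕ) then
              ρ ^ (m + 2) * (1 - ρ ^ (2 * ((n : ℤ) - 1).toNat + 2)) /
                (1 - ρ ^ (2 * (n + m + 1) + 2)) else 0) =
              ρ ^ (m + 2) * (1 - ρ ^ (2 * n)) / (1 - ρ ^ (2 * (n + m + 1) + 2)) := by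
            split_ifs with h
            · rw [show 2 * ((n : ℤ) - 1).toNat + 2 = 2 * n by omega]
            · rw [show n = 0 by omega]; simp
          rw [e1, e2, e3, e4, e5, Int.toNat_natCast]
          field_simp
          ring
      · right; left
        refine ⟨Set.ext fun w => ⟨fun hw => hw.2.1.eq_nil (by linarith [hw.2.2]), ?_⟩, ?_⟩
        · rintro rfl
          exact ⟨nonnegFrom_nil.mpr hk.1, StrictMax.nil, by simp⟩
        · rw [if_pos hk]
          simp
          exact hden.ne'
    · left
      exact ⟨hout hk, if_neg hk⟩

theorem sum_pow_two_mul_pos {ρ : ℝ} (h0 : 0 < ρ) (h : ℕ) :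
    0 < ∑ i ∈ Finset.range (h + 1), ρ ^ (2 * i) :=
  Finset.sum_pos (fun i _ => by positivity) (by simp)

theorem mass_isBridge_height' {ρ : ℝ} (h0 : 0 < ρ) (h1 : ρ < 1) (h : ℕ) :
    mass (ENNReal.ofReal (ρ / (1 + ρ ^ 2))) {w | IsBridge w ∧ height w = h} =
      ENNReal.ofReal (ρ ^ h / ∑ i ∈ Finset.range (h + 1), ρ ^ (2 * i)) := by
  rw [mass_isBridge_height h0 h1]
  congr 1
  have hden : 0 < 1 - ρ ^ (2 * h + 2) :=
    sub_pos.mpr (pow_lt_one₀ h0.le h1 (by omega))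
  have hgeom : (∑ i ∈ Finset.range (h + 1), ρ ^ (2 * i)) * (1 - ρ ^ 2) = 1 - ρ ^ (2 * h + 2) := by
    have := geom_sum_mul_neg (ρ ^ 2) (h + 1)
    simp only [← pow_mul] at this
    rw [this]
    ring_nf
  rw [div_eq_div_iff hden.ne' (sum_pow_two_mul_pos h0 h).ne', ← hgeom]
  ring

theorem le_mass_isBridge_height {ρ : ℝ} (h0 : 0 < ρ) (h1 : ρ < 1) (h : ℕ) :
    ENNReal.ofReal (ρ ^ h / (h + 1)) ≤
      mass (ENNReal.ofReal (ρ / (1 + ρ ^ 2))) {w | IsBridge w ∧ height w = h} := by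
  rw [mass_isBridge_height' h0 h1]
  refine ENNReal.ofReal_le_ofReal (div_le_div_of_nonneg_left (by positivity)
    (sum_pow_two_mul_pos h0 h) ?_)
  calc ∑ i ∈ Finset.range (h + 1), ρ ^ (2 * i) ≤ ∑ i ∈ Finset.range (h + 1), (1 : ℝ) :=
        Finset.sum_le_sum fun i _ => pow_le_one₀ h0.le h1.le
    _ = h + 1 := by simp

theorem mass_isBridge_height_le {ρ : ℝ} (h0 : 0 < ρ) (h1 : ρ < 1) (h : ℕ) :
    mass (ENNReal.ofReal (ρ / (1 + ρ ^ 2))) {w | IsBridge w ∧ height w = h} ≤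
      ENNReal.ofReal (1 / (h + 1)) := by
  rw [mass_isBridge_height' h0 h1]
  refine ENNReal.ofReal_le_ofReal ?_
  rw [div_le_div_iff₀ (sum_pow_two_mul_pos h0 h) (by positivity), one_mul]
  -- Pair the exponents `2 * i` and `2 * (h - i)` and apply the arithmetic-geometric mean
  -- inequality.
  have h2 : 2 * (ρ ^ h * (h + 1)) ≤ 2 * ∑ i ∈ Finset.range (h + 1), ρ ^ (2 * i) := by
    calc 2 * (ρ ^ h * (h + 1)) = ∑ i ∈ Finset.range (h + 1), 2 * ρ ^ h := by simp; ring
      _ ≤ ∑ i ∈ Finset.range (h + 1), (ρ ^ (2 * i) + ρ ^ (2 * (h - i))) := by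
        refine Finset.sum_le_sum fun i hi => ?_
        have hi' : i ≤ h := by simpa [Nat.lt_succ_iff] using hi
        have e1 : ρ ^ (2 * i) = (ρ ^ i) ^ 2 := by rw [← pow_mul, mul_comm]
        have e2 : ρ ^ (2 * (h - i)) = (ρ ^ (h - i)) ^ 2 := by rw [← pow_mul, mul_comm]
        have e3 : ρ ^ h = ρ ^ i * ρ ^ (h - i) := by rw [← pow_add, Nat.add_sub_cancel' hi']
        rw [e1, e2, e3]
        nlinarith [sq_nonneg (ρ ^ i - ρ ^ (h - i))]
      _ = 2 * ∑ i ∈ Finset.range (h + 1), ρ ^ (2 * i) := by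
        rw [Finset.sum_add_distrib, two_mul]
        congr 1
        have := Finset.sum_range_reflect (fun i => ρ ^ (2 * i)) (h + 1)
        simpa using this
  linarith


/-! ### Words with many cut times -/

theorem IsBridge.exists_irreducible {w : List Bool} (h : IsBridge w) (h0 : w ≠ []) :
    ∃ u v, w = u ++ v ∧ IsIrreducible u ∧ IsBridge v := by
  have hmem : w.length ∈ cutTimes w := mem_cutTimes_append (by simp) h0 h.2 NonnegPath.nil
  obtain ⟨u, v, rfl, hu0, hu, hv, hirr, -⟩ := exists_first_cut (Finset.card_pos.mpr ⟨_, hmem⟩)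
  refine ⟨u, v, rfl, ⟨⟨h.1.of_append_left, hu⟩, hu0, fun c d hcd hc hd => ?_⟩, hv,
    h.2.of_append_right⟩
  by_contra! hne
  exact hirr c d hcd hne.1 hne.2 hc.2 (hd.1.append hv)

/-- One half of the renewal equation: the empty bridge accounts for 1, and a nonempty bridge has at
most one factorization with irreducible first factor and bridge remainder. -/
theorem one_add_mass_irreducible_mul_le (x : ℝ≥0∞) :
    1 + mass x {w | IsIrreducible w} * mass x {w | IsBridge w} ≤ mass x {w | IsBridge w} := by
  have hsub : {w | IsIrreducible w} ⊆ {w | IsBridge w} := fun w hw => hw.1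
  calc 1 + mass x {w | IsIrreducible w} * mass x {w | IsBridge w}
      ≤ mass x {[]} + mass x ({w | IsBridge w} \ {[]}) := by
        rw [mass_singleton_nil]
        gcongr
        refine mass_mul_le ?_ ?_
        · intro a ha b hb
          refine ⟨ha.1.append hb, ?_⟩
          intro h
          exact ha.2.1 (List.append_eq_nil_iff.mp h).1
        · intro a ha a' ha' b hb b' hb' h
          exact irreducible_append_inj ha ha' hb.1 hb'.1 h
    _ = mass x {w | IsBridge w} := by
        rw [← mass_union Set.disjoint_sdiff_right, Set.union_sdiff_cancel]
        rintro w rfl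
        exact IsBridge.nil

theorem mass_isBridge_le (x : ℝ≥0∞) :
    mass x {w | IsBridge w} ≤ ∑' h : ℕ, mass x {w | IsBridge w ∧ height w = h} := by
  refine (mass_mono fun w hw => ?_).trans (mass_iUnion_le x _)
  exact Set.mem_iUnion.mpr ⟨(height w).toNat, hw, (Int.toNat_of_nonneg hw.1.height_nonneg).symm⟩

theorem mass_strictMax_le {ρ : ℝ} (h0 : 0 < ρ) (h1 : ρ < 1) :
    mass (ENNReal.ofReal (ρ / (1 + ρ ^ 2))) {w | StrictMax w} ≤ ENNReal.ofReal (1 / (1 - ρ)) := by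
  calc _ ≤ mass (ENNReal.ofReal (ρ / (1 + ρ ^ 2)))
        (⋃ h : ℕ, {w | StrictMax w ∧ height w = h}) := by
        refine mass_mono fun w hw => ?_
        exact Set.mem_iUnion.mpr
          ⟨(height w).toNat, hw, (Int.toNat_of_nonneg hw.height_nonneg).symm⟩
    _ ≤ ∑' h : ℕ, ENNReal.ofReal (ρ ^ h) := by
        refine (mass_iUnion_le _ _).trans_eq (tsum_congr fun h => ?_)
        exact mass_strictMax_height h0 h1 h
    _ = ENNReal.ofReal (1 / (1 - ρ)) := by
        rw [← ENNReal.ofReal_tsum_of_nonneg (fun n => by positivity)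
          (summable_geometric_of_lt_one h0.le h1), tsum_geometric_of_lt_one h0.le h1, one_div]

theorem sum_one_div_eq_harmonic (n : ℕ) :
    ∑ h ∈ Finset.range n, (1 : ℝ) / (h + 1) = harmonic n := by
  simp [harmonic]

/-- Heights below `m` contribute a harmonic sum. Above `m`, the bound `ρ ^ m ≤ 1 / 2` keeps the
denominators away from 0 and leaves a geometric series of total at most 2. -/
theorem mass_isBridge_le_log {m : ℕ} (hm : 2 ≤ m) {ρ : ℝ} (hρ : ρ = 1 - 1 / m) :
    mass (ENNReal.ofReal (ρ / (1 + ρ ^ 2))) {w | IsBridge w} ≤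
      ENNReal.ofReal (Real.log m + 3) := by
  have hm' : (2 : ℝ) ≤ m := by exact_mod_cast hm
  have hinv : 1 / (m : ℝ) ≤ 1 / 2 := one_div_le_one_div_of_le (by norm_num) hm'
  have hinv0 : 0 < 1 / (m : ℝ) := by positivity
  have h0 : 0 < ρ := by linarith
  have h1 : ρ < 1 := by linarith
  have hpow : ρ ^ m ≤ 1 / 2 := by
    have h2 : ρ ≤ Real.exp (-(1 / m)) := by rw [hρ]; exact Real.one_sub_le_exp_neg _
    calc ρ ^ m ≤ Real.exp (-(1 / m)) ^ m := by gcongr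
      _ = Real.exp (-1) := by
        rw [← Real.exp_nat_mul]
        congr 1
        field_simp
      _ ≤ 1 / 2 := by
        rw [Real.exp_neg, ← one_div]
        exact one_div_le_one_div_of_le (by norm_num) (by linarith [Real.add_one_le_exp (1 : ℝ)])
  set x := ENNReal.ofReal (ρ / (1 + ρ ^ 2)) with hx
  have hhead : ∑ h ∈ Finset.range m, mass x {w | IsBridge w ∧ height w = (h : ℕ)} ≤
      ENNReal.ofReal (1 + Real.log m) := by
    calc _ ≤ ∑ h ∈ Finset.range m, ENNReal.ofReal (1 / ((h : ℝ) + 1)) :=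
          Finset.sum_le_sum fun h _ => mass_isBridge_height_le h0 h1 h
      _ = ENNReal.ofReal (harmonic m) := by
          rw [← ENNReal.ofReal_sum_of_nonneg (fun i _ => by positivity), sum_one_div_eq_harmonic]
      _ ≤ _ := ENNReal.ofReal_le_ofReal (harmonic_le_one_add_log m)
  have htail : ∑' h : ℕ, mass x {w | IsBridge w ∧ height w = (h + m : ℕ)} ≤
      ENNReal.ofReal 2 := by
    have hden : (1 : ℝ) / 2 ≤ 1 - ρ ^ m := by linarith
    calc _ ≤ ∑' h : ℕ, ENNReal.ofReal ((2 * (1 - ρ)) * ρ ^ h) := by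
          refine ENNReal.tsum_le_tsum fun h => ?_
          rw [mass_isBridge_height h0 h1]
          refine ENNReal.ofReal_le_ofReal ?_
          have h3 : ρ ^ (2 * (h + m) + 2) ≤ ρ ^ m := pow_le_pow_of_le_one h0.le h1.le (by omega)
          rw [div_le_iff₀ (by linarith)]
          have h4 : ρ ^ (h + m) ≤ ρ ^ h * (1 / 2) := by
            rw [pow_add]; gcongr
          have h5 : 0 < ρ ^ h := by positivity
          have h6 : 1 - ρ ^ 2 ≤ 2 * (1 - ρ) := by nlinarith
          calc ρ ^ (h + m) * (1 - ρ ^ 2) ≤ (ρ ^ h * (1 / 2)) * (2 * (1 - ρ)) := by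
                gcongr
                nlinarith
            _ = 2 * (1 - ρ) * ρ ^ h * (1 / 2) := by ring
            _ ≤ 2 * (1 - ρ) * ρ ^ h * (1 - ρ ^ (2 * (h + m) + 2)) := by
                gcongr
                linarith
      _ = ENNReal.ofReal 2 := by
          rw [← ENNReal.ofReal_tsum_of_nonneg (fun n => by
              have : 0 < 1 - ρ := by linarith
              positivity)
            ((summable_geometric_of_lt_one h0.le h1).mul_left _), tsum_mul_left,
            tsum_geometric_of_lt_one h0.le h1]
          congr 1
          have : 1 - ρ ≠ 0 := by linarith
          field_simp
  calc mass x {w | IsBridge w} ≤ ∑' h : ℕ, mass x {w | IsBridge w ∧ height w = h} :=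
        mass_isBridge_le x
    _ = ∑ h ∈ Finset.range m, mass x {w | IsBridge w ∧ height w = (h : ℕ)} +
          ∑' h : ℕ, mass x {w | IsBridge w ∧ height w = (h + m : ℕ)} :=
        (ENNReal.summable.sum_add_tsum_nat_add' (f := fun h : ℕ =>
          mass x {w | IsBridge w ∧ height w = h})).symm
    _ ≤ ENNReal.ofReal (1 + Real.log m) + ENNReal.ofReal 2 := by gcongr
    _ = ENNReal.ofReal (Real.log m + 3) := by
        rw [← ENNReal.ofReal_add (by have := Real.log_nonneg (by linarith : (1 : ℝ) ≤ m); linarith)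
          (by norm_num)]
        congr 1
        ring

theorem mass_irreducible_le {m : ℕ} (hm : 2 ≤ m) {ρ : ℝ} (hρ : ρ = 1 - 1 / m) :
    mass (ENNReal.ofReal (ρ / (1 + ρ ^ 2))) {w | IsIrreducible w} ≤
      ENNReal.ofReal (1 - 1 / (Real.log m + 3)) := by
  have h1 : ρ < 1 := by
    have : 0 < 1 / (m : ℝ) := by positivity
    linarith
  set x := ENNReal.ofReal (ρ / (1 + ρ ^ 2)) with hx
  have hfin : ∀ L, mass x L ≠ ∞ := fun L =>
    (mass_lt_top (ofReal_lt_half (div_one_add_sq_lt_half h1)) L).ne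
  have hlog : 0 ≤ Real.log m := Real.log_natCast_nonneg m
  have hU : (mass x {w | IsBridge w}).toReal ≤ Real.log m + 3 := by
    refine ENNReal.toReal_le_of_le_ofReal (by linarith) (mass_isBridge_le_log hm hρ)
  have hF := ENNReal.toReal_mono (hfin _) (one_add_mass_irreducible_mul_le x)
  rw [ENNReal.toReal_add ENNReal.one_ne_top (ENNReal.mul_ne_top (hfin _) (hfin _)),
    ENNReal.toReal_mul, ENNReal.toReal_one] at hF
  set U := (mass x {w | IsBridge w}).toReal
  set F := (mass x {w | IsIrreducible w}).toReal with hFdef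
  have hF0 : 0 ≤ F := ENNReal.toReal_nonneg
  have hU0 : 0 ≤ U := ENNReal.toReal_nonneg
  have hU1 : 1 ≤ U := by nlinarith
  rw [← ENNReal.ofReal_toReal (hfin {w | IsIrreducible w})]
  refine ENNReal.ofReal_le_ofReal ?_
  rw [← hFdef]
  have h2 : F ≤ 1 - 1 / U := by
    have : 0 < U := by linarith
    rw [le_sub_iff_add_le, ← mul_le_mul_iff_left₀ this, add_mul, one_div_mul_cancel this.ne']
    linarith
  have h3 : 1 / (Real.log m + 3) ≤ 1 / U := one_div_le_one_div_of_le (by linarith) hU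
  linarith

theorem mass_irreducibleProducts_le (x : ℝ≥0∞) (n : ℕ) :
    mass x (irreducibleProducts n) ≤ mass x {w | IsIrreducible w} ^ n := by
  induction n with
  | zero => simp [irreducibleProducts]
  | succ n ih =>
    rw [pow_succ']
    exact (mass_image2_le x _ _).trans (by gcongr)

/-- The initial strict-maximum word has mass at most `m`, the final nonnegative path at most `2 *
m`, and each of the `n` irreducible bridges in between contributes a factor `1 - 1 / (log m + 3)`.
-/
theorem mass_many_cutTimes_le {m : ℕ} (hm : 2 ≤ m) {ρ : ℝ} (hρ : ρ = 1 - 1 / m) (n : ℕ) :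
    mass (ENNReal.ofReal (ρ / (1 + ρ ^ 2))) {w | n < (cutTimes w).card} ≤
      ENNReal.ofReal (2 * m ^ 2 * (1 - 1 / (Real.log m + 3)) ^ n) := by
  have hm' : (2 : ℝ) ≤ m := by exact_mod_cast hm
  have hinv : 1 / (m : ℝ) ≤ 1 / 2 := one_div_le_one_div_of_le (by norm_num) hm'
  have hinv0 : 0 < 1 / (m : ℝ) := by positivity
  have h0 : 0 < ρ := by linarith
  have h1 : ρ < 1 := by linarith
  have h2 : 1 - ρ = 1 / m := by linarith
  have hlog : 0 ≤ Real.log m := Real.log_natCast_nonneg m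
  have hF0 : 0 ≤ 1 - 1 / (Real.log m + 3) := by
    rw [sub_nonneg, div_le_one (by linarith)]
    linarith
  set x := ENNReal.ofReal (ρ / (1 + ρ ^ 2)) with hx
  calc mass x {w | n < (cutTimes w).card}
      ≤ mass x (Set.image2 (· ++ ·) {w | StrictMax w}
          (Set.image2 (· ++ ·) (irreducibleProducts n) {w | NonnegPath w})) :=
        mass_mono fun w hw => mem_of_lt_card_cutTimes hw
    _ ≤ mass x {w | StrictMax w} * (mass x (irreducibleProducts n) * mass x {w | NonnegPath w}) :=
        (mass_image2_le x _ _).trans (by gcongr; exact mass_image2_le x _ _)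
    _ ≤ ENNReal.ofReal m * (ENNReal.ofReal ((1 - 1 / (Real.log m + 3)) ^ n) *
          ENNReal.ofReal (2 * m)) := by
        gcongr
        · refine (mass_strictMax_le h0 h1).trans_eq ?_
          rw [h2, one_div_one_div]
        · refine (mass_irreducibleProducts_le x n).trans ?_
          rw [ENNReal.ofReal_pow hF0]
          gcongr
          exact mass_irreducible_le hm hρ
        · rw [hx, mass_nonnegPath h0 h1]
          refine ENNReal.ofReal_le_ofReal ?_
          rw [h2, div_div_eq_mul_div, div_one]
          gcongr
          nlinarith
    _ = _ := by
        rw [← ENNReal.ofReal_mul (by positivity), ← ENNReal.ofReal_mul (by positivity)]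
        congr 1
        ring


/-! ### A prefix code of words with many cut times -/

theorem mass_union_le (x : ℝ≥0∞) (A B : Set (List Bool)) :
    mass x (A ∪ B) ≤ mass x A + mass x B :=
  ENNReal.tsum_union_le (fun w : List Bool => x ^ w.length) A B

/-- The other half of the renewal equation. It survives truncation at height `H` because heights of
factors are nonnegative and add up. -/
theorem mass_isBridge_le_irreducible (x : ℝ≥0∞) (H : ℕ) :
    mass x {w | IsBridge w ∧ height w ≤ H} ≤
      1 + mass x {w | IsIrreducible w ∧ height w ≤ H} *
        mass x {w | IsBridge w ∧ height w ≤ H} := by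
  calc mass x {w | IsBridge w ∧ height w ≤ H}
      ≤ mass x ({[]} ∪ Set.image2 (· ++ ·) {w | IsIrreducible w ∧ height w ≤ H}
          {w | IsBridge w ∧ height w ≤ H}) := by
        refine mass_mono ?_
        rintro w ⟨hw, hH⟩
        rcases eq_or_ne w [] with rfl | h0
        · exact Or.inl rfl
        · right
          obtain ⟨u, v, rfl, hu, hv⟩ := hw.exists_irreducible h0
          rw [height_append] at hH
          have := hu.1.1.height_nonneg
          have := hv.1.height_nonneg
          exact ⟨u, ⟨hu, by omega⟩, v, ⟨hv, by omega⟩, rfl⟩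
    _ ≤ _ := by
        refine (mass_union_le x _ _).trans ?_
        rw [mass_singleton_nil]
        gcongr
        exact mass_image2_le x _ _

theorem mass_height_le_eq_sum (x : ℝ≥0∞) (P : List Bool → Prop) (hP : ∀ w, P w → 0 ≤ height w)
    (H : ℕ) :
    mass x {w | P w ∧ height w ≤ H} =
      ∑ h ∈ Finset.range (H + 1), mass x {w | P w ∧ height w = (h : ℕ)} := by
  refine le_antisymm ?_ (sum_mass_le _ ?_ ?_)
  · calc _ ≤ mass x (⋃ h : Finset.range (H + 1), {w | P w ∧ height w = (h : ℕ)}) := by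
          refine mass_mono ?_
          rintro w ⟨hw, hH⟩
          have := hP w hw
          refine Set.mem_iUnion.mpr ⟨⟨(height w).toNat, ?_⟩, hw, ?_⟩
          · rw [Finset.mem_range]; omega
          · dsimp only; omega
      _ ≤ _ := by
          refine (mass_iUnion_le _ _).trans_eq ?_
          rw [tsum_fintype]
          exact Finset.sum_coe_sort (Finset.range (H + 1))
            (fun h : ℕ => mass x {w | P w ∧ height w = (h : ℕ)})
  · intro i _ j _ hij
    refine Set.disjoint_left.mpr ?_
    rintro w ⟨-, h1⟩ ⟨-, h2⟩
    omega
  · rintro i hi w ⟨h1, h2⟩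
    rw [Finset.mem_range] at hi
    exact ⟨h1, by omega⟩

theorem le_mass_irreducible {ρ : ℝ} (h0 : 0 < ρ) (h1 : ρ < 1) {H : ℕ} {u : ℝ} (hu : 0 < u)
    (huH : u ≤ ρ ^ H * Real.log H) :
    ENNReal.ofReal (1 - 1 / u) ≤
      mass (ENNReal.ofReal (ρ / (1 + ρ ^ 2))) {w | IsIrreducible w ∧ height w ≤ H} := by
  set x := ENNReal.ofReal (ρ / (1 + ρ ^ 2)) with hx
  have hfin : ∀ L, mass x L ≠ ∞ := fun L =>
    (mass_lt_top (ofReal_lt_half (div_one_add_sq_lt_half h1)) L).ne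
  have hU : ENNReal.ofReal u ≤ mass x {w | IsBridge w ∧ height w ≤ H} := by
    rw [mass_height_le_eq_sum x _ fun w hw => hw.1.height_nonneg]
    calc ENNReal.ofReal u
        ≤ ENNReal.ofReal (∑ h ∈ Finset.range (H + 1), ρ ^ h / (h + 1)) := by
          refine ENNReal.ofReal_le_ofReal (huH.trans ?_)
          calc ρ ^ H * Real.log H ≤ ρ ^ H * harmonic (H + 1) := by
                gcongr
                rcases Nat.eq_zero_or_pos H with rfl | hH
                · simp [harmonic]
                · refine le_trans (Real.log_le_log (by positivity) ?_)
                    (log_add_one_le_harmonic (H + 1))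
                  push_cast
                  linarith
            _ = ∑ h ∈ Finset.range (H + 1), ρ ^ H * (1 / ((h : ℝ) + 1)) := by
                rw [← Finset.mul_sum, sum_one_div_eq_harmonic]
            _ ≤ _ := by
                refine Finset.sum_le_sum fun h hh => ?_
                rw [mul_one_div]
                gcongr ?_ / _
                refine pow_le_pow_of_le_one h0.le h1.le ?_
                rw [Finset.mem_range] at hh
                omega
      _ = ∑ h ∈ Finset.range (H + 1), ENNReal.ofReal (ρ ^ h / (h + 1)) :=
          ENNReal.ofReal_sum_of_nonneg fun i _ => by positivity
      _ ≤ _ := Finset.sum_le_sum fun h _ => le_mass_isBridge_height h0 h1 h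
  have hF := ENNReal.toReal_mono (ENNReal.add_ne_top.mpr ⟨ENNReal.one_ne_top,
    ENNReal.mul_ne_top (hfin _) (hfin _)⟩) (mass_isBridge_le_irreducible x H)
  rw [ENNReal.toReal_add ENNReal.one_ne_top (ENNReal.mul_ne_top (hfin _) (hfin _)),
    ENNReal.toReal_mul, ENNReal.toReal_one] at hF
  have hU' := ENNReal.toReal_mono (hfin _) hU
  rw [ENNReal.toReal_ofReal hu.le] at hU'
  set U := (mass x {w | IsBridge w ∧ height w ≤ H}).toReal
  rw [← ENNReal.ofReal_toReal (hfin {w | IsIrreducible w ∧ height w ≤ H})]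
  refine ENNReal.ofReal_le_ofReal ?_
  set F := (mass x {w | IsIrreducible w ∧ height w ≤ H}).toReal
  have hUpos : 0 < U := by linarith
  have h2 : 1 - 1 / U ≤ F := by
    rw [sub_le_iff_le_add, ← mul_le_mul_iff_left₀ hUpos, add_mul, one_div_mul_cancel hUpos.ne']
    linarith
  have h3 : 1 / U ≤ 1 / u := one_div_le_one_div_of_le hu hU'
  linarith

/-- Each appended irreducible bridge adds a cut time at its end. The base case supplies a
strict-maximum word that pads the height to exactly `M`, which places every word in the
first-passage code of level `M`. Uniqueness of the last irreducible factor keeps the contributions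
of different heights `h` disjoint. -/
theorem le_mass_many_cutTimes {ρ : ℝ} (h0 : 0 < ρ) (h1 : ρ < 1) (H K M : ℕ) (hM : K * H ≤ M) :
    mass (ENNReal.ofReal (ρ / (1 + ρ ^ 2))) {w | IsIrreducible w ∧ height w ≤ H} ^ K *
        ENNReal.ofReal (ρ ^ M) ≤
      mass (ENNReal.ofReal (ρ / (1 + ρ ^ 2)))
        {w | StrictMax w ∧ height w = M ∧ K ≤ (cutTimes w).card} := by
  set x := ENNReal.ofReal (ρ / (1 + ρ ^ 2)) with hx
  induction K generalizing M with
  | zero =>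
    rw [pow_zero, one_mul, ← mass_strictMax_height h0 h1 M]
    exact mass_mono fun w hw => ⟨hw.1, hw.2, Nat.zero_le _⟩
  | succ K ih =>
    set F := mass x {w | IsIrreducible w ∧ height w ≤ H} with hF
    rw [Nat.succ_mul] at hM
    let A : ℕ → Set (List Bool) := fun h =>
      Set.image2 (· ++ ·) {w | StrictMax w ∧ height w = (M - h : ℕ) ∧ K ≤ (cutTimes w).card}
        {w | IsIrreducible w ∧ height w = (h : ℕ)}
    calc F ^ (K + 1) * ENNReal.ofReal (ρ ^ M)
        = F ^ K * ENNReal.ofReal (ρ ^ M) *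
            ∑ h ∈ Finset.range (H + 1), mass x {w | IsIrreducible w ∧ height w = (h : ℕ)} := by
          rw [← mass_height_le_eq_sum x _ fun w hw => hw.1.1.height_nonneg, ← hF]
          ring
      _ = ∑ h ∈ Finset.range (H + 1), F ^ K * ENNReal.ofReal (ρ ^ M) *
            mass x {w | IsIrreducible w ∧ height w = (h : ℕ)} := Finset.mul_sum _ _ _
      _ ≤ ∑ h ∈ Finset.range (H + 1), mass x (A h) := by
          refine Finset.sum_le_sum fun h hh => ?_
          rw [Finset.mem_range] at hh
          calc F ^ K * ENNReal.ofReal (ρ ^ M) *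
                mass x {w | IsIrreducible w ∧ height w = (h : ℕ)}
              ≤ F ^ K * ENNReal.ofReal (ρ ^ (M - h)) *
                mass x {w | IsIrreducible w ∧ height w = (h : ℕ)} := by
                gcongr _ * ENNReal.ofReal ?_ * _
                exact pow_le_pow_of_le_one h0.le h1.le (Nat.sub_le _ _)
            _ ≤ mass x {w | StrictMax w ∧ height w = (M - h : ℕ) ∧ K ≤ (cutTimes w).card} *
                mass x {w | IsIrreducible w ∧ height w = (h : ℕ)} := by
                gcongr
                exact ih (M - h) (by omega)
            _ ≤ mass x (A h) := by
                refine mass_mul_le (fun a ha b hb => ⟨a, ha, b, hb, rfl⟩) ?_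
                intro a ha a' ha' b hb b' hb' h
                exact append_irreducible_inj hb.1 hb'.1 ha.1 ha'.1 h
      _ ≤ _ := by
          refine sum_mass_le _ ?_ ?_
          · intro i _ j _ hij
            refine Set.disjoint_left.mpr ?_
            rintro _ ⟨a, ha, b, hb, rfl⟩ ⟨a', ha', b', hb', h⟩
            obtain ⟨-, rfl⟩ := append_irreducible_inj hb'.1 hb.1 ha'.1 ha.1 h
            have := hb.2
            have := hb'.2
            omega
          · rintro h hh _ ⟨a, ha, b, hb, rfl⟩
            rw [Finset.mem_range] at hh
            have := ha.2.1
            have := hb.2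
            refine ⟨ha.1.append hb.1.1.2, ?_, ?_⟩
            · rw [height_append]; omega
            · have := card_cutTimes_append_right ha.1 hb.1.1 hb.1.2.1
              have := ha.2.2
              dsimp only
              omega

/-! ### Prefix codes and repeated attempts. -/

/-- No word of the set is a proper prefix of another one. -/
def IsPrefixCode (X : Set (List Bool)) : Prop :=
  ∀ w ∈ X, ∀ r, w ++ r ∈ X → r = []

/-- Concatenations of fewer than `n` words of `B` and a final word of `G`. -/
def retries (G B : Set (List Bool)) : ℕ → Set (List Bool)
  | 0 => ∅
  | n + 1 => G ∪ Set.image2 (· ++ ·) B (retries G B n)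

theorem disjoint_retries {V G : Set (List Bool)}
    (hV : ∀ a ∈ V, ∀ a' ∈ V, ∀ b b', a ++ b = a' ++ b' → a = a' ∧ b = b') (hG : G ⊆ V)
    (X : Set (List Bool)) :
    Disjoint G (Set.image2 (· ++ ·) (V \ G) X) := by
  refine Set.disjoint_left.mpr ?_
  rintro g hg ⟨a, ha, b, hb, h⟩
  obtain ⟨rfl, -⟩ := hV a ha.1 g (hG hg) b [] (by simpa using h)
  exact ha.2 hg

theorem isPrefixCode_retries {V G : Set (List Bool)}
    (hV : ∀ a ∈ V, ∀ a' ∈ V, ∀ b b', a ++ b = a' ++ b' → a = a' ∧ b = b') (hG : G ⊆ V)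
    (n : ℕ) : IsPrefixCode (retries G (V \ G) n) := by
  induction n with
  | zero => intro w hw; exact absurd hw (Set.notMem_empty w)
  | succ n ih =>
    rintro w (hw | ⟨a, ha, y, hy, rfl⟩) r (hr | ⟨a', ha', y', hy', h⟩)
    · exact (hV w (hG hw) _ (hG hr) r [] (by simp)).2
    · obtain ⟨rfl, -⟩ := hV a' ha'.1 w (hG hw) y' r h
      exact absurd hw ha'.2
    · obtain ⟨h1, -⟩ := hV a ha.1 _ (hG hr) (y ++ r) [] (by simp)
      rw [← h1] at hr
      exact absurd hr ha.2
    · obtain ⟨rfl, rfl⟩ := hV a' ha'.1 a ha.1 y' (y ++ r) (by simpa using h)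
      exact ih y hy r hy'

theorem mass_retries_succ {V G : Set (List Bool)}
    (hV : ∀ a ∈ V, ∀ a' ∈ V, ∀ b b', a ++ b = a' ++ b' → a = a' ∧ b = b') (hG : G ⊆ V)
    (x : ℝ≥0∞) (n : ℕ) :
    mass x G + mass x (V \ G) * mass x (retries G (V \ G) n) ≤
      mass x (retries G (V \ G) (n + 1)) := by
  rw [retries, mass_union (disjoint_retries hV hG _)]
  gcongr
  refine mass_mul_le (fun a ha b hb => ⟨a, ha, b, hb, rfl⟩) ?_
  intro a ha a' ha' b _ b' _ h
  exact hV a ha.1 a' ha'.1 b b' h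

/-- With `g` and `b` the masses of success and failure of one attempt, unlimited attempts give `g /
(1 - b)`. The hypothesis says that the killed mass `1 - g - b` is at most `g`, so this is at least
`1 / 2`; finitely many attempts exceed `1 / 3`. -/
theorem exists_third_le_mass_retries {V G : Set (List Bool)}
    (hV : ∀ a ∈ V, ∀ a' ∈ V, ∀ b b', a ++ b = a' ++ b' → a = a' ∧ b = b') (hG : G ⊆ V)
    {x : ℝ≥0∞} (hx : x < 2⁻¹) (hV1 : mass x V ≤ 1)
    (hg0 : 0 < mass x G) (hg : 1 ≤ mass x V + mass x G) :
    ∃ n, ENNReal.ofReal (1 / 3) ≤ mass x (retries G (V \ G) n) := by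
  have hfin : ∀ L, mass x L ≠ ∞ := fun L => (mass_lt_top hx L).ne
  set g := (mass x G).toReal with hgdef
  set b := (mass x (V \ G)).toReal with hbdef
  have hgpos : 0 < g := ENNReal.toReal_pos hg0.ne' (hfin _)
  have hb0 : 0 ≤ b := ENNReal.toReal_nonneg
  have hsum : mass x G + mass x (V \ G) = mass x V := by
    rw [← mass_union Set.disjoint_sdiff_right, Set.union_sdiff_cancel hG]
  have hv : (mass x V).toReal = g + b := by
    rw [← hsum, ENNReal.toReal_add (hfin _) (hfin _)]
  have hv1 : g + b ≤ 1 := by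
    rw [← hv]
    exact ENNReal.toReal_le_of_le_ofReal zero_le_one (by simpa using hV1)
  have hvg : 1 ≤ g + b + g := by
    have := ENNReal.toReal_mono (ENNReal.add_ne_top.mpr ⟨hfin _, hfin _⟩) hg
    rwa [ENNReal.toReal_add (hfin _) (hfin _), hv, ENNReal.toReal_one] at this
  have hrec : ∀ n, g + b * (mass x (retries G (V \ G) n)).toReal ≤
      (mass x (retries G (V \ G) (n + 1))).toReal := by
    intro n
    have := ENNReal.toReal_mono (hfin _) (mass_retries_succ hV hG x n)
    rwa [ENNReal.toReal_add (hfin _) (ENNReal.mul_ne_top (hfin _) (hfin _)),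
      ENNReal.toReal_mul] at this
  have hbound : ∀ n, (1 - b ^ n) / 2 ≤ (mass x (retries G (V \ G) n)).toReal := by
    intro n
    induction n with
    | zero => simp
    | succ n ih =>
      refine le_trans ?_ (hrec n)
      have := mul_le_mul_of_nonneg_left ih hb0
      rw [pow_succ']
      nlinarith
  have hlim : Tendsto (fun n : ℕ => (1 - b ^ n) / 2) atTop (𝓝 ((1 - 0) / 2)) :=
    ((tendsto_pow_atTop_nhds_zero_of_lt_one hb0 (by linarith)).const_sub 1).div_const 2
  obtain ⟨n, hn⟩ := (hlim.eventually (lt_mem_nhds (by norm_num : (1 / 3 : ℝ) < (1 - 0) / 2))).exists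
  refine ⟨n, ?_⟩
  rw [← ENNReal.ofReal_toReal (hfin (retries G (V \ G) n))]
  exact ENNReal.ofReal_le_ofReal (hn.le.trans (hbound n))

/-- An attempt is a first passage to level `M`. The cut times of the final good word survive all
earlier failures because each failed word ends at a strict maximum. -/
theorem exists_prefixCode_of_le_mass {ρ : ℝ} (h0 : 0 < ρ) (h1 : ρ < 1) (K M : ℕ)
    (hg0 : 0 < mass (ENNReal.ofReal (ρ / (1 + ρ ^ 2)))
        {w | StrictMax w ∧ height w = M ∧ K ≤ (cutTimes w).card})
    (hg : ENNReal.ofReal (1 - ρ ^ M) ≤ mass (ENNReal.ofReal (ρ / (1 + ρ ^ 2)))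
        {w | StrictMax w ∧ height w = M ∧ K ≤ (cutTimes w).card}) :
    ∃ X, IsPrefixCode X ∧ (∀ w ∈ X, K ≤ (cutTimes w).card) ∧
      ENNReal.ofReal (1 / 3) ≤ mass (ENNReal.ofReal (ρ / (1 + ρ ^ 2))) X := by
  set x := ENNReal.ofReal (ρ / (1 + ρ ^ 2)) with hx
  set G := {w | StrictMax w ∧ height w = M ∧ K ≤ (cutTimes w).card} with hGdef
  set V := {w | StrictMax w ∧ height w = M} with hVdef
  have hV : ∀ a ∈ V, ∀ a' ∈ V, ∀ b b', a ++ b = a' ++ b' → a = a' ∧ b = b' :=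
    fun a ha a' ha' b b' h => strictMax_append_inj ha.1 ha'.1 (ha.2.trans ha'.2.symm) h
  have hG : G ⊆ V := fun w hw => ⟨hw.1, hw.2.1⟩
  have hmV : mass x V = ENNReal.ofReal (ρ ^ M) := mass_strictMax_height h0 h1 M
  have hpow : ρ ^ M ≤ 1 := pow_le_one₀ h0.le h1.le
  obtain ⟨n, hn⟩ := exists_third_le_mass_retries hV hG
    (ofReal_lt_half (div_one_add_sq_lt_half h1)) (by rw [← hx, hmV]; simpa using hpow) hg0 (by
      calc (1 : ℝ≥0∞) = ENNReal.ofReal (ρ ^ M) + ENNReal.ofReal (1 - ρ ^ M) := by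
            rw [← ENNReal.ofReal_add (by positivity) (by linarith)]
            simp
        _ ≤ _ := by rw [← hx, hmV]; gcongr)
  refine ⟨_, isPrefixCode_retries hV hG n, ?_, hn⟩
  clear hn
  induction n with
  | zero => intro w hw; exact absurd hw (Set.notMem_empty w)
  | succ n ih =>
    rintro w (hw | ⟨a, ha, y, hy, rfl⟩)
    · exact hw.2.2
    · exact (ih y hy).trans (card_cutTimes_append_left ha.1.1)


/-! ### Rarely visited edges and cut times -/

/-- The word of the first `n` letters of a sequence. -/
def prefixWord (x : ℕ → Bool) (n : ℕ) : List Bool := (List.range n).map x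

/-- The path with steps encoded by `x`. -/
def walk (x : ℕ → Bool) (n : ℕ) : ℤ := height (prefixWord x n)

@[simp] theorem length_prefixWord (x : ℕ → Bool) (n : ℕ) : (prefixWord x n).length = n := by
  simp [prefixWord]

@[simp] theorem walk_zero (x : ℕ → Bool) : walk x 0 = 0 := rfl

theorem walk_succ (x : ℕ → Bool) (n : ℕ) : walk x (n + 1) = walk x n + stepValue (x n) := by
  simp [walk, prefixWord, List.range_succ]

theorem prefixWord_add (x : ℕ → Bool) (m n : ℕ) :
    prefixWord x (m + n) = prefixWord x m ++ prefixWord (fun i => x (m + i)) n := by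
  simp [prefixWord, List.range_add, Function.comp_def]

theorem walk_succ' (x : ℕ → Bool) (n : ℕ) :
    walk x (n + 1) = stepValue (x 0) + walk (fun i => x (i + 1)) n := by
  rw [walk, add_comm n 1, prefixWord_add, height_append]
  simp [walk, prefixWord, add_comm]

theorem walk_not (x : ℕ → Bool) (n : ℕ) : walk (fun i => !x i) n = -walk x n := by
  induction n with
  | zero => rfl
  | succ n ih => rw [walk_succ, walk_succ, ih, stepValue_not]; ring

theorem walk_succ_eq (x : ℕ → Bool) (n : ℕ) :
    walk x (n + 1) = walk x n + 1 ∨ walk x (n + 1) = walk x n - 1 := by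
  rw [walk_succ]
  cases x n <;> simp [sub_eq_add_neg]

theorem prefixWord_eq_append {x : ℕ → Bool} {n : ℕ} {p q : List Bool}
    (h : prefixWord x n = p ++ q) : p.length ≤ n ∧ p = prefixWord x p.length ∧
      height q = walk x n - walk x p.length := by
  have hlen : n = p.length + q.length := by
    have := congrArg List.length h
    simpa using this
  have h2 := prefixWord_add x p.length q.length
  rw [← hlen, h] at h2
  obtain ⟨h3, h4⟩ := List.append_inj h2 (by simp)
  refine ⟨by omega, h3, ?_⟩
  rw [walk, walk, h, height_append, ← h3]
  ring

theorem strictMax_prefixWord {x : ℕ → Bool} {k : ℕ} :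
    StrictMax (prefixWord x k) ↔ ∀ j < k, walk x j < walk x k := by
  constructor
  · intro h j hj
    obtain ⟨i, rfl⟩ := Nat.exists_eq_add_of_le hj.le
    have h1 := prefixWord_add x j i
    rw [h1] at h
    have := h.height_lt (by rw [← List.length_pos_iff]; simp; omega)
    rwa [← h1] at this
  · intro h p q hpq hq
    obtain ⟨h1, -, h3⟩ := prefixWord_eq_append hpq
    have hlen := congrArg List.length hpq
    simp only [length_prefixWord, List.length_append] at hlen
    have := List.length_pos_iff.mpr hq
    have := h p.length (by omega)
    omega

theorem mem_cutTimes_prefixWord {x : ℕ → Bool} {n k : ℕ} :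
    k ∈ cutTimes (prefixWord x n) ↔ (0 < k ∧ k ≤ n) ∧ (∀ j < k, walk x j < walk x k) ∧
      ∀ j, k ≤ j → j ≤ n → walk x k ≤ walk x j := by
  rw [mem_cutTimes, length_prefixWord]
  refine and_congr_right fun hk => ?_
  obtain ⟨m, rfl⟩ := Nat.exists_eq_add_of_le hk.2
  have h1 : (prefixWord x (k + m)).take k = prefixWord x k := by
    rw [prefixWord_add, List.take_append_of_le_length (by simp), List.take_of_length_le (by simp)]
  have h2 : (prefixWord x (k + m)).drop k = prefixWord (fun i => x (k + i)) m := by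
    rw [prefixWord_add, List.drop_append_of_le_length (by simp), List.drop_of_length_le (by simp),
      List.nil_append]
  have h3 : ∀ i, walk x (k + i) = walk x k + walk (fun i => x (k + i)) i := fun i => by
    rw [walk, prefixWord_add, height_append]; rfl
  rw [h1, h2, strictMax_prefixWord]
  refine and_congr_right fun _ => ⟨fun h j hj hjn => ?_, fun h p q hpq => ?_⟩
  · obtain ⟨i, rfl⟩ := Nat.exists_eq_add_of_le hj
    have h4 : 0 ≤ walk (fun i => x (k + i)) i := by
      obtain ⟨r, rfl⟩ : ∃ r, m = i + r := ⟨m - i, by omega⟩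
      exact h _ _ (prefixWord_add _ i r)
    rw [h3]
    omega
  · obtain ⟨h5, h6, -⟩ := prefixWord_eq_append hpq
    have := h (k + p.length) (by omega) (by omega)
    rw [h3] at this
    rw [h6]
    exact (by omega : (0 : ℤ) ≤ walk (fun i => x (k + i)) p.length)

theorem upcrossings_pos {s : ℕ → ℤ} {y : ℤ} {n : ℕ} :
    0 < upcrossings s y n ↔ ∃ k, (0 < k ∧ k ≤ n) ∧ s k = y ∧ s (k - 1) = y - 1 := by
  simp [upcrossings, Finset.card_pos, Finset.Nonempty]

theorem downcrossings_pos {s : ℕ → ℤ} {y : ℤ} {n : ℕ} :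
    0 < downcrossings s y n ↔ ∃ k, (0 < k ∧ k ≤ n) ∧ s k = y ∧ s (k - 1) = y + 1 := by
  simp [downcrossings, Finset.card_pos, Finset.Nonempty]

theorem downcrossings_walk (x : ℕ → Bool) (y : ℤ) (n : ℕ) :
    downcrossings (walk x) y n = upcrossings (walk fun i => !x i) (-y) n := by
  simp only [downcrossings, upcrossings, walk_not]
  congr 1
  refine Finset.filter_congr fun k _ => ?_
  omega

theorem upcrossings_walk (x : ℕ → Bool) (y : ℤ) (n : ℕ) :
    upcrossings (walk x) y n = downcrossings (walk fun i => !x i) (-y) n := by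
  simp only [downcrossings, upcrossings, walk_not]
  congr 1
  refine Finset.filter_congr fun k _ => ?_
  omega

/-- The edge just below the position at a cut time is crossed only at that moment. Different cut
times give different edges since positions at cut times increase strictly. -/
theorem card_cutTimes_le_numRarelyVisitedEdges (x : ℕ → Bool) (n : ℕ) :
    (cutTimes (prefixWord x n)).card ≤ numRarelyVisitedEdges (walk x) n := by
  rw [numRarelyVisitedEdges, ← Set.ncard_coe_finset]
  refine Set.ncard_le_ncard_of_injOn (fun k => walk x k - 1) ?_ ?_ (finite_rarelyVisitedEdges _ _)
  · intro k hk
    rw [Finset.mem_coe, mem_cutTimes_prefixWord] at hk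
    obtain ⟨⟨hk0, hkn⟩, h1, h2⟩ := hk
    change upcrossings _ _ _ + downcrossings _ _ _ = 1
    have hdown : downcrossings (walk x) (walk x k - 1) n = 0 := by
      by_contra hne
      obtain ⟨j, ⟨hj0, hjn⟩, h3, h4⟩ := downcrossings_pos.mp (Nat.pos_of_ne_zero hne)
      rcases lt_or_ge j k with hj | hj
      · have := h1 (j - 1) (by omega)
        omega
      · have := h2 j hj hjn
        omega
    have hup : upcrossings (walk x) (walk x k - 1 + 1) n = 1 := by
      rw [upcrossings, Finset.card_eq_one]
      refine ⟨k, Finset.ext fun j => ?_⟩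
      simp only [Finset.mem_filter, Finset.mem_Ioc, Finset.mem_singleton]
      constructor
      · rintro ⟨⟨hj0, hjn⟩, h3, h4⟩
        rcases lt_trichotomy j k with hj | hj | hj
        · have := h1 j hj
          omega
        · exact hj
        · have := h2 (j - 1) (by omega) (by omega)
          omega
      · rintro rfl
        refine ⟨⟨hk0, hkn⟩, by omega, ?_⟩
        obtain ⟨i, rfl⟩ : ∃ i, j = i + 1 := ⟨j - 1, by omega⟩
        have := h1 i (by omega)
        have := walk_succ_eq x i
        rw [Nat.add_sub_cancel]
        omega
    omega
  · have key : ∀ i ∈ cutTimes (prefixWord x n), ∀ j ∈ cutTimes (prefixWord x n), i < j →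
        walk x i < walk x j := fun i _ j hj hij => (mem_cutTimes_prefixWord.mp hj).2.1 i hij
    intro i hi j hj hij
    simp only at hij
    rcases lt_trichotomy i j with h | h | h
    · have := key i hi j hj h
      omega
    · exact h
    · have := key j hj i hi h
      omega

/-- Without a downward crossing, the path cannot pass from above the edge to below it. Running
backwards from `k - 1` it therefore stays at or below `y`, and forwards from `k` it stays at or
above `y + 1`. -/
theorem mem_cutTimes_of_upcrossing {x : ℕ → Bool} {n k : ℕ} {y : ℤ} (hk : 0 < k ∧ k ≤ n)
    (h1 : walk x k = y + 1) (h2 : walk x (k - 1) = y) (hdown : downcrossings (walk x) y n = 0) :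
    k ∈ cutTimes (prefixWord x n) := by
  have hno : ∀ j, j < n → ¬ (walk x (j + 1) = y ∧ walk x j = y + 1) := by
    rintro j hj ⟨h3, h4⟩
    have : 0 < downcrossings (walk x) y n :=
      downcrossings_pos.mpr ⟨j + 1, by omega, h3, by simpa using h4⟩
    omega
  rw [mem_cutTimes_prefixWord]
  refine ⟨hk, ?_, ?_⟩
  · have hback : ∀ i, i < k → walk x (k - 1 - i) ≤ y := by
      intro i
      induction i with
      | zero => intro _; exact h2.le
      | succ i ih =>
        intro hi
        have h3 := ih (by omega)
        obtain ⟨j, hj⟩ : ∃ j, k - 1 - i = j + 1 := ⟨k - 1 - i - 1, by omega⟩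
        rw [show k - 1 - (i + 1) = j by omega]
        rw [hj] at h3
        have := hno j (by omega)
        have := walk_succ_eq x j
        by_contra hlt
        omega
    intro j hj
    have := hback (k - 1 - j) (by omega)
    rw [show k - 1 - (k - 1 - j) = j by omega] at this
    omega
  · intro j hj
    induction j, hj using Nat.le_induction with
    | base => intro _; exact le_rfl
    | succ j hj ih =>
      intro hjn
      have h3 := ih (by omega)
      have := hno j (by omega)
      have := walk_succ_eq x j
      by_contra hlt
      omega

theorem ncard_le_card_cutTimes {x : ℕ → Bool} {n : ℕ} {R : Set ℤ}
    (hR : ∀ y ∈ R, downcrossings (walk x) y n = 0 ∧ 0 < upcrossings (walk x) (y + 1) n) :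
    R.ncard ≤ (cutTimes (prefixWord x n)).card := by
  have hsub : R ⊆ ((cutTimes (prefixWord x n)).image fun k => walk x k - 1 : Finset ℤ) := by
    intro y hy
    obtain ⟨h1, h2⟩ := hR y hy
    obtain ⟨k, hk, h3, h4⟩ := upcrossings_pos.mp h2
    rw [Finset.mem_coe, Finset.mem_image]
    exact ⟨k, mem_cutTimes_of_upcrossing hk h3 (by omega) h1, by omega⟩
  exact (Set.ncard_le_ncard hsub (Finset.finite_toSet _)).trans
    ((Set.ncard_coe_finset _).le.trans Finset.card_image_le)

theorem walk_pos_of_upcrossing {x : ℕ → Bool} {n : ℕ} {y : ℤ}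
    (h1 : downcrossings (walk x) y n = 0) (h2 : 0 < upcrossings (walk x) (y + 1) n) :
    0 < walk x n := by
  obtain ⟨k, hk, h3, h4⟩ := upcrossings_pos.mp h2
  obtain ⟨-, h5, h6⟩ :=
    mem_cutTimes_prefixWord.mp (mem_cutTimes_of_upcrossing hk h3 (by omega) h1)
  have := h5 0 hk.1
  have := h6 n hk.2 le_rfl
  rw [walk_zero] at *
  omega

/-- The sign of the endpoint decides the direction: an edge crossed only upwards forces a positive
endpoint, and one crossed only downwards a negative endpoint. The second case is the first one for
the reflected path. -/
theorem numRarelyVisitedEdges_le (x : ℕ → Bool) (n : ℕ) :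
    numRarelyVisitedEdges (walk x) n ≤ (cutTimes (prefixWord x n)).card ∨
      numRarelyVisitedEdges (walk x) n ≤ (cutTimes (prefixWord (fun i => !x i) n)).card := by
  have hmem : ∀ y ∈ rarelyVisitedEdges (walk x) n,
      upcrossings (walk x) (y + 1) n + downcrossings (walk x) y n = 1 := fun y hy => hy
  rcases lt_or_ge 0 (walk x n) with hpos | hneg
  · left
    refine ncard_le_card_cutTimes fun y hy => ?_
    have h1 := hmem y hy
    suffices upcrossings (walk x) (y + 1) n ≠ 0 by omega
    intro h0
    have := walk_pos_of_upcrossing (x := fun i => !x i) (n := n) (y := -(y + 1))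
      (by rw [← upcrossings_walk]; exact h0)
      (by rw [show -(y + 1) + 1 = -y by ring, ← downcrossings_walk]; omega)
    rw [walk_not] at this
    omega
  · right
    rw [numRarelyVisitedEdges, ← Set.ncard_image_of_injective (rarelyVisitedEdges (walk x) n)
      (f := fun y => -(y + 1)) (fun a b h => by simpa using h)]
    refine ncard_le_card_cutTimes ?_
    rintro _ ⟨y, hy, rfl⟩
    have h1 := hmem y hy
    rw [← upcrossings_walk, show -(y + 1) + 1 = -y by ring, ← downcrossings_walk]
    suffices downcrossings (walk x) y n ≠ 0 by omega
    intro h0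
    have := walk_pos_of_upcrossing h0 (by omega)
    omega

/-! ### Dependence on the first step -/

theorem sum_Ioc_zero_eq_sum_range (f : ℕ → ℕ) (n : ℕ) :
    ∑ k ∈ Finset.Ioc 0 n, f k = ∑ i ∈ Finset.range n, f (i + 1) := by
  have : Finset.Ioc 0 n = Finset.Ico 1 (n + 1) := by
    ext; simp; omega
  rw [this, Finset.sum_Ico_eq_sum_range]
  simp [add_comm]

theorem edgeVisits_succ {s t : ℕ → ℤ} {c : ℤ} (hst : ∀ n, s (n + 1) = c + t n) (y : ℤ) (n : ℕ) :
    edgeVisits s y (n + 1) = edgeVisits t (y - c) n +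
      ((if s 1 = y + 1 ∧ s 0 = y then 1 else 0) + if s 1 = y ∧ s 0 = y + 1 then 1 else 0) := by
  simp only [edgeVisits, upcrossings, downcrossings, Finset.card_filter,
    sum_Ioc_zero_eq_sum_range, Nat.add_sub_cancel]
  rw [Finset.sum_range_succ', Finset.sum_range_succ']
  simp only [hst, zero_add, add_sub_cancel_right]
  rw [add_add_add_comm]
  congr 2
  · refine Finset.sum_congr rfl fun i _ => if_congr ?_ rfl rfl
    omega
  · refine Finset.sum_congr rfl fun i _ => if_congr ?_ rfl rfl
    omega

theorem numRarelyVisitedEdges_shift (x : ℕ → Bool) (n : ℕ) :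
    numRarelyVisitedEdges (walk x) (n + 1) ≤
        numRarelyVisitedEdges (walk fun i => x (i + 1)) n + 1 ∧
      numRarelyVisitedEdges (walk fun i => x (i + 1)) n ≤
        numRarelyVisitedEdges (walk x) (n + 1) + 1 := by
  set c := stepValue (x 0) with hc
  obtain ⟨e, he⟩ : ∃ e : ℤ, ∀ y ≠ e, edgeVisits (walk x) y (n + 1) =
      edgeVisits (walk fun i => x (i + 1)) (y - c) n := by
    -- The exceptional edge is the one crossed by the first step.
    refine ⟨if x 0 then 0 else -1, fun y hy => ?_⟩
    rw [edgeVisits_succ (walk_succ' x) y n, walk_succ, walk_zero, ← hc]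
    cases h : x 0 <;> simp [h] at hy hc <;> rw [hc, if_neg (by omega), if_neg (by omega)] <;> rfl
  have hinj : Function.Injective fun y : ℤ => y + c := add_left_injective c
  constructor
  · have hsub : rarelyVisitedEdges (walk x) (n + 1) ⊆
        insert e ((fun y => y + c) '' rarelyVisitedEdges (walk fun i => x (i + 1)) n) := by
      intro y hy
      by_cases hye : y = e
      · exact Or.inl hye
      · exact Or.inr ⟨y - c, (he y hye).symm.trans hy, by simp⟩
    refine (Set.ncard_le_ncard hsub
      (((finite_rarelyVisitedEdges _ _).image _).insert _)).trans ?_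
    refine (Set.ncard_insert_le _ _).trans ?_
    rw [Set.ncard_image_of_injective _ hinj]
    rfl
  · have hsub : (fun y => y + c) '' rarelyVisitedEdges (walk fun i => x (i + 1)) n ⊆
        insert e (rarelyVisitedEdges (walk x) (n + 1)) := by
      rintro _ ⟨y, hy, rfl⟩
      by_cases hye : y + c = e
      · exact Or.inl hye
      · refine Or.inr ((he _ hye).trans ?_)
        rw [add_sub_cancel_right]
        exact hy
    have := (Set.ncard_le_ncard hsub ((finite_rarelyVisitedEdges _ _).insert _)).trans
      (Set.ncard_insert_le _ _)
    rwa [Set.ncard_image_of_injective _ hinj] at this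


/-! ### Fair coin tossing -/

/-- The law of a fair coin. -/
noncomputable def coin : Measure Bool := (2⁻¹ : ℝ≥0∞) • (Measure.dirac true + Measure.dirac false)

theorem coin_singleton (b : Bool) : coin {b} = 2⁻¹ := by
  cases b <;> simp [coin]

instance : IsProbabilityMeasure coin :=
  ⟨by simp [coin, ENNReal.inv_two_add_inv_two]⟩

/-- The law of an infinite sequence of independent fair coins. -/
noncomputable def coinSeq : Measure (ℕ → Bool) := Measure.infinitePi fun _ => coin

instance : IsProbabilityMeasure coinSeq := by unfold coinSeq; infer_instance

theorem prefixWord_eq_iff {x : ℕ → Bool} {w : List Bool} :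
    prefixWord x w.length = w ↔ ∀ i ∈ Finset.range w.length, w[i]? = some (x i) := by
  constructor
  · intro h i hi
    rw [Finset.mem_range] at hi
    rw [← h]
    simp [prefixWord, hi]
  · intro h
    refine List.ext_getElem? fun i => ?_
    by_cases hi : i < w.length
    · rw [h i (by simpa using hi)]
      simp [prefixWord, hi]
    · rw [List.getElem?_eq_none (by simpa using hi), List.getElem?_eq_none (by simpa using hi)]

/-- The sequences starting with the word `w`. -/
def wordCylinder (w : List Bool) : Set (ℕ → Bool) := {x | prefixWord x w.length = w}

theorem wordCylinder_eq_pi (w : List Bool) :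
    wordCylinder w = Set.pi (Finset.range w.length) fun i => {b | w[i]? = some b} := by
  ext x
  exact prefixWord_eq_iff

theorem measurableSet_wordCylinder (w : List Bool) : MeasurableSet (wordCylinder w) := by
  rw [wordCylinder_eq_pi]
  exact MeasurableSet.pi (Set.to_countable _) fun _ _ => MeasurableSet.of_discrete

theorem coinSeq_wordCylinder (w : List Bool) : coinSeq (wordCylinder w) = 2⁻¹ ^ w.length := by
  rw [wordCylinder_eq_pi, coinSeq, Measure.infinitePi_pi _ fun _ _ => MeasurableSet.of_discrete]
  rw [Finset.prod_congr rfl (g := fun _ => (2⁻¹ : ℝ≥0∞))]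
  · simp
  · intro i hi
    rw [Finset.mem_range] at hi
    have : {b | w[i]? = some b} = {w[i]} := by
      ext b
      simp [hi, eq_comm]
    rw [this, coin_singleton]

theorem IsPrefixCode.coinSeq_iUnion {X : Set (List Bool)} (hX : IsPrefixCode X) :
    coinSeq (⋃ w ∈ X, wordCylinder w) = mass 2⁻¹ X := by
  rw [measure_biUnion (Set.to_countable X) ?_ fun w _ => measurableSet_wordCylinder w]
  · exact tsum_congr fun w => coinSeq_wordCylinder w
  · have key : ∀ w ∈ X, ∀ w' ∈ X, w.length ≤ w'.length → ∀ x, x ∈ wordCylinder w →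
        x ∈ wordCylinder w' → w = w' := by
      intro w hw w' hw' hle x hx hx'
      obtain ⟨k, hk⟩ := Nat.exists_eq_add_of_le hle
      have h1 : w' = w ++ prefixWord (fun i => x (w.length + i)) k := by
        have h2 := prefixWord_add x w.length k
        rwa [← hk, show prefixWord x w'.length = w' from hx',
          show prefixWord x w.length = w from hx] at h2
      rw [h1] at hw'
      rw [h1, hX w hw _ hw', List.append_nil]
    intro w hw w' hw' hne
    refine Set.disjoint_left.mpr fun x hx hx' => hne ?_
    rcases le_total w.length w'.length with h | h
    · exact key w hw w' hw' h x hx hx'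
    · exact (key w' hw' w hw h x hx' hx).symm

theorem isPrefixCode_of_length (A : Set (List Bool)) (n : ℕ) :
    IsPrefixCode {w | w ∈ A ∧ w.length = n} := by
  rintro w ⟨-, h1⟩ r ⟨-, h2⟩
  rw [List.length_append] at h2
  exact List.length_eq_zero_iff.mp (by omega)

theorem coinSeq_prefixWord_mem (A : Set (List Bool)) (n : ℕ) :
    coinSeq {x | prefixWord x n ∈ A} = mass 2⁻¹ {w | w ∈ A ∧ w.length = n} := by
  rw [← (isPrefixCode_of_length A n).coinSeq_iUnion]
  congr 1
  ext x
  simp only [Set.mem_iUnion, wordCylinder]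
  constructor
  · intro hx
    exact ⟨prefixWord x n, ⟨hx, by simp⟩, by simp⟩
  · rintro ⟨w, ⟨hw, rfl⟩, hx⟩
    change prefixWord x w.length ∈ A
    rwa [show prefixWord x w.length = w from hx]

theorem measurableSet_prefixWord_mem (A : Set (List Bool)) (n : ℕ) :
    MeasurableSet {x | prefixWord x n ∈ A} := by
  have : {x | prefixWord x n ∈ A} = ⋃ w ∈ {w | w ∈ A ∧ w.length = n}, wordCylinder w := by
    ext x
    simp only [Set.mem_iUnion, wordCylinder]
    constructor
    · intro hx
      exact ⟨prefixWord x n, ⟨hx, by simp⟩, by simp⟩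
    · rintro ⟨w, ⟨hw, rfl⟩, hx⟩
      change prefixWord x w.length ∈ A
      rwa [show prefixWord x w.length = w from hx]
  rw [this]
  exact MeasurableSet.biUnion (Set.to_countable _) fun w _ => measurableSet_wordCylinder w

/-! ### Comparison of the killed walk with coin tossing. -/

theorem mass_le_mul_mass {x y c : ℝ≥0∞} {A : Set (List Bool)}
    (h : ∀ w ∈ A, x ^ w.length ≤ c * y ^ w.length) : mass x A ≤ c * mass y A := by
  rw [mass, mass, ← ENNReal.tsum_mul_left]
  exact ENNReal.tsum_le_tsum fun w => h w w.2

/-- Words of different lengths are different, so the fixed-time probabilities sum into one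
generating function. The factor `c` pays for replacing `2⁻¹` by `x` up to time `N`. -/
theorem sum_coinSeq_prefixWord_mem_le {x c : ℝ≥0∞} {N : ℕ}
    (h : ∀ n < N, (2⁻¹ : ℝ≥0∞) ^ n ≤ c * x ^ n) (A : Set (List Bool)) :
    ∑ n ∈ Finset.range N, coinSeq {x | prefixWord x n ∈ A} ≤ c * mass x A := by
  calc ∑ n ∈ Finset.range N, coinSeq {x | prefixWord x n ∈ A}
      ≤ ∑ n ∈ Finset.range N, c * mass x {w | w ∈ A ∧ w.length = n} := by
        refine Finset.sum_le_sum fun n hn => ?_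
        rw [coinSeq_prefixWord_mem]
        refine mass_le_mul_mass ?_
        rintro w ⟨-, rfl⟩
        exact h _ (by simpa using hn)
    _ = c * ∑ n ∈ Finset.range N, mass x {w | w ∈ A ∧ w.length = n} := by rw [Finset.mul_sum]
    _ ≤ c * mass x A := by
        gcongr
        refine sum_mass_le _ ?_ fun n _ w hw => hw.1
        intro i _ j _ hij
        refine Set.disjoint_left.mpr ?_
        rintro w ⟨-, h1⟩ ⟨-, h2⟩
        omega

/-- Here `z` is the survival probability per step: words of length at most `N` cost no more than
under coin tossing, and longer ones require surviving at least `N` steps. -/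
theorem IsPrefixCode.mass_le {X : Set (List Bool)} (hX : IsPrefixCode X) {x z : ℝ≥0∞}
    (hz : z ≤ 1) (hx : x = z * 2⁻¹) (N : ℕ) :
    mass x X ≤ coinSeq {s | ∃ n ≤ N, prefixWord s n ∈ X} + z ^ N := by
  have hsub : IsPrefixCode {w | w ∈ X ∧ w.length ≤ N} := fun w hw r hr => hX w hw.1 r hr.1
  calc mass x X ≤ mass x ({w | w ∈ X ∧ w.length ≤ N} ∪ {w | w ∈ X ∧ N < w.length}) := by
        refine mass_mono fun w hw => ?_
        rcases le_or_gt w.length N with h | h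
        · exact Or.inl ⟨hw, h⟩
        · exact Or.inr ⟨hw, h⟩
    _ ≤ mass x {w | w ∈ X ∧ w.length ≤ N} + mass x {w | w ∈ X ∧ N < w.length} :=
        mass_union_le x _ _
    _ ≤ 1 * mass 2⁻¹ {w | w ∈ X ∧ w.length ≤ N} +
          z ^ N * mass 2⁻¹ {w | w ∈ X ∧ N < w.length} := by
        gcongr
        · refine mass_le_mul_mass fun w _ => ?_
          rw [hx, mul_pow]
          gcongr
          exact pow_le_one₀ zero_le hz
        · refine mass_le_mul_mass fun w hw => ?_
          rw [hx, mul_pow]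
          gcongr ?_ * _
          exact pow_le_pow_of_le_one zero_le hz hw.2.le
    _ ≤ coinSeq {s | ∃ n ≤ N, prefixWord s n ∈ X} + z ^ N * 1 := by
        rw [one_mul, ← hsub.coinSeq_iUnion]
        gcongr
        · refine Set.iUnion₂_subset fun w hw s hs => ⟨w.length, hw.2, ?_⟩
          rw [show prefixWord s w.length = w from hs]
          exact hw.1
        · refine (mass_mono (L' := X) fun w hw => hw.1).trans ?_
          rw [← hX.coinSeq_iUnion]
          exact prob_le_one
    _ = _ := by rw [mul_one]

theorem coinSeq_map_not : coinSeq.map (fun x i => !x i) = coinSeq := by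
  have h : coin.map not = coin := by
    refine Measure.ext_of_singleton fun b => ?_
    rw [Measure.map_apply Measurable.of_discrete (measurableSet_singleton b)]
    have : not ⁻¹' {b} = {!b} := by ext c; cases b <;> cases c <;> simp
    rw [this, coin_singleton, coin_singleton]
  have := Measure.infinitePi_map_pi (μ := fun _ : ℕ => coin) (f := fun _ => not)
    fun _ => Measurable.of_discrete
  simp only [h] at this
  exact this

theorem coinSeq_prefixWord_not_mem (A : Set (List Bool)) (n : ℕ) :
    coinSeq {x | prefixWord (fun i => !x i) n ∈ A} = coinSeq {x | prefixWord x n ∈ A} := by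
  have hmeas : Measurable fun (x : ℕ → Bool) i => !x i := measurable_pi_lambda _ fun i =>
    (Measurable.of_discrete (f := not)).comp (measurable_pi_apply i)
  conv_rhs => rw [← coinSeq_map_not, Measure.map_apply hmeas (measurableSet_prefixWord_mem A n)]
  rfl


/-! ### The upper bound -/

theorem two_inv_pow_le {m : ℕ} (hm : 2 ≤ m) {ρ : ℝ} (hρ : ρ = 1 - 1 / m) {n : ℕ}
    (hn : 2 * n ≤ m ^ 2) :
    (2⁻¹ : ℝ≥0∞) ^ n ≤ 2 * ENNReal.ofReal (ρ / (1 + ρ ^ 2)) ^ n := by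
  have hm' : (2 : ℝ) ≤ m := by exact_mod_cast hm
  have hinv : 1 / (m : ℝ) ≤ 1 / 2 := one_div_le_one_div_of_le (by norm_num) hm'
  have hinv0 : 0 < 1 / (m : ℝ) := by positivity
  have h0 : 0 < ρ := by linarith
  have hn' : 2 * (n : ℝ) ≤ m ^ 2 := by exact_mod_cast hn
  have hsq : (1 / (m : ℝ)) ^ 2 * m ^ 2 = 1 := by field_simp
  -- The killing probability `(1 - ρ) ^ 2 / (1 + ρ ^ 2)` is at most `1 / m ^ 2`, so by Bernoulli's
  -- inequality survival up to time `n` has probability at least `1 / 2`.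
  have hz : 1 - (1 / (m : ℝ)) ^ 2 ≤ 2 * (ρ / (1 + ρ ^ 2)) := by
    rw [mul_div_assoc', le_div_iff₀ (by positivity)]
    have : 1 / (m : ℝ) = 1 - ρ := by linarith
    rw [this]
    nlinarith [mul_nonneg (sq_nonneg (1 - ρ)) (sq_nonneg ρ)]
  have hpow : (1 : ℝ) / 2 ≤ (2 * (ρ / (1 + ρ ^ 2))) ^ n := by
    have h1 : (1 / (m : ℝ)) ^ 2 ≤ 1 := by nlinarith
    calc (1 : ℝ) / 2 ≤ 1 + n * (-(1 / (m : ℝ)) ^ 2) := by nlinarith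
      _ ≤ (1 + -(1 / (m : ℝ)) ^ 2) ^ n := one_add_mul_le_pow (by linarith) n
      _ ≤ _ := by gcongr; linarith; linarith
  have h2 : (2⁻¹ : ℝ≥0∞) = ENNReal.ofReal (1 / 2) := by
    rw [one_div, ENNReal.ofReal_inv_of_pos (by norm_num)]; simp
  rw [h2, ← ENNReal.ofReal_pow (by norm_num), ← ENNReal.ofReal_pow (by positivity),
    show (2 : ℝ≥0∞) = ENNReal.ofReal 2 by simp, ← ENNReal.ofReal_mul (by norm_num)]
  refine ENNReal.ofReal_le_ofReal ?_
  rw [mul_pow] at hpow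
  have h3 : (1 / 2 : ℝ) ^ n * 2 ^ n = 1 := by rw [← mul_pow]; norm_num
  have h4 : (0 : ℝ) < (1 / 2) ^ n := by positivity
  nlinarith [mul_le_mul_of_nonneg_left hpow h4.le]

theorem coinSeq_many_rarelyVisited_le {m : ℕ} (hm : 2 ≤ m) {N : ℕ} (hN : 2 * N ≤ m ^ 2) (K : ℕ) :
    coinSeq {x | ∃ n < N, K < numRarelyVisitedEdges (walk x) n} ≤
      ENNReal.ofReal (8 * m ^ 2 * (1 - 1 / (Real.log m + 3)) ^ K) := by
  set A : Set (List Bool) := {w | K < (cutTimes w).card}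
  set ρ : ℝ := 1 - 1 / m with hρ
  set x := ENNReal.ofReal (ρ / (1 + ρ ^ 2))
  have hsum : ∑ n ∈ Finset.range N, coinSeq {x | prefixWord x n ∈ A} ≤ 2 * mass x A :=
    sum_coinSeq_prefixWord_mem_le (fun n hn => two_inv_pow_le hm hρ (by omega)) A
  calc coinSeq {x | ∃ n < N, K < numRarelyVisitedEdges (walk x) n}
      ≤ coinSeq (⋃ n ∈ Finset.range N, ({x | prefixWord x n ∈ A} ∪
          {x | prefixWord (fun i => !x i) n ∈ A})) := by
        refine measure_mono ?_
        rintro x ⟨n, hn, hx⟩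
        refine Set.mem_biUnion (Finset.mem_coe.mpr (Finset.mem_range.mpr hn)) ?_
        rcases numRarelyVisitedEdges_le x n with h | h
        · exact Or.inl (hx.trans_le h)
        · exact Or.inr (hx.trans_le h)
    _ ≤ ∑ n ∈ Finset.range N, (coinSeq {x | prefixWord x n ∈ A} +
          coinSeq {x | prefixWord x n ∈ A}) := by
        refine (measure_biUnion_finset_le _ _).trans (Finset.sum_le_sum fun n _ => ?_)
        refine (measure_union_le _ _).trans_eq ?_
        rw [coinSeq_prefixWord_not_mem]
    _ ≤ 2 * mass x A + 2 * mass x A := by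
        rw [Finset.sum_add_distrib]
        gcongr
    _ = ENNReal.ofReal 4 * mass x A := by
        rw [← add_mul]
        norm_num
    _ ≤ ENNReal.ofReal 4 * ENNReal.ofReal (2 * m ^ 2 * (1 - 1 / (Real.log m + 3)) ^ K) := by
        gcongr
        exact mass_many_cutTimes_le hm hρ K
    _ = _ := by
        rw [← ENNReal.ofReal_mul (by norm_num)]
        congr 1
        ring

/-- With `a = j * log 2`, the prefactor grows like `exp (2 * a)` while the power decays like `exp
(-4 * c * a)`; the ratio is geometric in `j` exactly when `c > 1 / 2`. -/
theorem summable_upper_bound {c : ℝ} (hc : 1 / 2 < c) :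
    Summable fun j : ℕ => 8 * ((2 ^ (j + 2) : ℕ) : ℝ) ^ 2 *
      (1 - 1 / (Real.log (2 ^ (j + 2) : ℕ) + 3)) ^ ⌊c * Real.log (4 ^ j : ℕ) ^ 2⌋₊ := by
  set l := Real.log 2 with hl
  have hl0 : 0 < l := Real.log_pos (by norm_num)
  have hlog4 : ∀ j : ℕ, Real.log (4 ^ j : ℕ) = 2 * (j * l) := by
    intro j
    rw [Nat.cast_pow, Real.log_pow, show ((4 : ℕ) : ℝ) = 2 ^ 2 by norm_num, Real.log_pow]
    push_cast
    ring
  have hlog2 : ∀ j : ℕ, Real.log (2 ^ (j + 2) : ℕ) = j * l + 2 * l := by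
    intro j
    rw [Nat.cast_pow, Real.log_pow]
    push_cast
    ring
  set b := 2 * l + 3 with hb
  set D := 8 * Real.exp (4 * l + 4 * c * b + 1) with hD
  refine Summable.of_nonneg_of_le (f := fun j : ℕ => D * Real.exp ((2 - 4 * c) * l) ^ j)
    (fun j => ?_) (fun j => ?_) ?_
  · rw [hlog2]
    have : 0 ≤ 1 - 1 / (j * l + 2 * l + 3) := by
      rw [sub_nonneg, div_le_one (by positivity)]
      nlinarith [mul_nonneg (Nat.cast_nonneg (α := ℝ) j) hl0.le]
    positivity
  · rw [hlog2, hlog4]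
    set a := (j : ℝ) * l with ha
    have ha0 : 0 ≤ a := by positivity
    set U := a + 2 * l + 3 with hU
    have hU1 : 1 ≤ U := by linarith
    set K := ⌊c * (2 * a) ^ 2⌋₊ with hK
    have hK1 : 4 * c * a ^ 2 - 1 ≤ K := by
      have := Nat.lt_floor_add_one (c * (2 * a) ^ 2)
      rw [← hK] at this
      nlinarith
    have h1 : ((2 ^ (j + 2) : ℕ) : ℝ) ^ 2 = Real.exp (2 * a + 4 * l) := by
      rw [← Real.exp_log (x := ((2 ^ (j + 2) : ℕ) : ℝ)) (by positivity), hlog2, ← Real.exp_nat_mul]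
      congr 1
      push_cast
      ring
    have h2 : (1 - 1 / U) ^ K ≤ Real.exp (-(K / U)) := by
      have h3 : 0 ≤ 1 - 1 / U := by
        rw [sub_nonneg, div_le_one (by positivity)]
        exact hU1
      calc (1 - 1 / U) ^ K ≤ Real.exp (-(1 / U)) ^ K := by
            gcongr
            exact Real.one_sub_le_exp_neg _
        _ = _ := by
            rw [← Real.exp_nat_mul]
            congr 1
            ring
    -- Since `U = a + b`, this follows from `(a - b) * (a + b) ≤ a ^ 2`.
    have h4 : 4 * c * (a - b) - 1 ≤ K / U := by
      rw [le_div_iff₀ (by positivity)]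
      have : U = a + b := by rw [hU, hb]; ring
      rw [this] at hU1 ⊢
      nlinarith [mul_nonneg (by linarith : (0 : ℝ) ≤ c) (sq_nonneg b)]
    rw [h1, hD, ← Real.exp_nat_mul, mul_assoc, mul_assoc, ← Real.exp_add]
    gcongr ?_ * ?_
    calc Real.exp (2 * a + 4 * l) * (1 - 1 / U) ^ K
        ≤ Real.exp (2 * a + 4 * l) * Real.exp (-(K / U)) := by gcongr
      _ = Real.exp (2 * a + 4 * l + -(K / U)) := (Real.exp_add _ _).symm
      _ ≤ _ := by
        refine Real.exp_le_exp.mpr ?_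
        rw [show (j : ℝ) * ((2 - 4 * c) * l) = (2 - 4 * c) * a by rw [ha]; ring]
        linarith
  · refine (summable_geometric_of_lt_one (Real.exp_pos _).le ?_).mul_left D
    rw [Real.exp_lt_one_iff]
    nlinarith

theorem ae_eventually_numRarelyVisitedEdges_le {c : ℝ} (hc : 1 / 2 < c) :
    ∀ᵐ x ∂coinSeq, ∀ᶠ n : ℕ in atTop,
      (numRarelyVisitedEdges (walk x) n : ℝ) ≤ c * Real.log n ^ 2 := by
  have hsum : ∑' j : ℕ, coinSeq {x | ∃ n < 4 ^ (j + 1),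
      ⌊c * Real.log (4 ^ j : ℕ) ^ 2⌋₊ < numRarelyVisitedEdges (walk x) n} ≠ ∞ := by
    refine ne_top_of_le_ne_top ?_ (ENNReal.tsum_le_tsum fun j =>
      coinSeq_many_rarelyVisited_le (m := 2 ^ (j + 2)) ?_ ?_ _)
    · exact (summable_upper_bound hc).tsum_ofReal_ne_top
    · calc 2 = 2 ^ 1 := rfl
        _ ≤ 2 ^ (j + 2) := Nat.pow_le_pow_right (by norm_num) (by omega)
    · rw [← pow_mul, show (4 : ℕ) = 2 ^ 2 by norm_num, ← pow_mul, ← pow_succ']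
      exact Nat.pow_le_pow_right (by norm_num) (by omega)
  filter_upwards [ae_eventually_notMem hsum] with x hx
  obtain ⟨J, hJ⟩ := eventually_atTop.mp hx
  refine eventually_atTop.mpr ⟨4 ^ J, fun n hn => ?_⟩
  have hn0 : n ≠ 0 := by
    have : 0 < 4 ^ J := by positivity
    omega
  have h1 := hJ (Nat.log 4 n) (Nat.le_log_of_pow_le (by norm_num) hn)
  have h2 : numRarelyVisitedEdges (walk x) n ≤ ⌊c * Real.log (4 ^ Nat.log 4 n : ℕ) ^ 2⌋₊ := by
    by_contra h
    exact h1 ⟨n, Nat.lt_pow_succ_log_self (by norm_num) n, not_le.mp h⟩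
  have h3 : 4 ^ Nat.log 4 n ≤ n := Nat.pow_log_le_self 4 hn0
  calc (numRarelyVisitedEdges (walk x) n : ℝ)
      ≤ c * Real.log (4 ^ Nat.log 4 n : ℕ) ^ 2 :=
        (Nat.le_floor_iff (by positivity)).mp h2
    _ ≤ c * Real.log n ^ 2 := by
        gcongr


/-! ### The lower bound -/

/-- The retry code has mass at least `1 / 3` for the killed walk, and codewords longer than `N`
account for at most `1 / 8`, which leaves more than `1 / 6`. -/
theorem le_coinSeq_many_cutTimes {ρ : ℝ} (h0 : 0 < ρ) (h1 : ρ < 1) {H K N : ℕ} {u : ℝ}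
    (hu : 1 < u) (huH : u ≤ ρ ^ H * Real.log H)
    (hg : 1 - ρ ^ (K * H) ≤ (1 - 1 / u) ^ K * ρ ^ (K * H))
    (hN : (2 * (ρ / (1 + ρ ^ 2))) ^ N ≤ 1 / 8) :
    ENNReal.ofReal (1 / 6) ≤
      coinSeq {x | ∃ n ≤ N, K ≤ (cutTimes (prefixWord x n)).card} := by
  have hx := div_one_add_sq_lt_half h1
  have hu0 : 0 < 1 - 1 / u := by
    rw [sub_pos, div_lt_one (by linarith)]
    exact hu
  have hmass : ENNReal.ofReal ((1 - 1 / u) ^ K * ρ ^ (K * H)) ≤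
      mass (ENNReal.ofReal (ρ / (1 + ρ ^ 2)))
        {w | StrictMax w ∧ height w = (K * H : ℕ) ∧ K ≤ (cutTimes w).card} := by
    refine le_trans ?_ (le_mass_many_cutTimes h0 h1 H K (K * H) le_rfl)
    rw [ENNReal.ofReal_mul (by positivity), ENNReal.ofReal_pow hu0.le]
    gcongr
    exact le_mass_irreducible h0 h1 (by linarith) huH
  obtain ⟨X, hX, hXK, hXmass⟩ := exists_prefixCode_of_le_mass h0 h1 K (K * H)
    (lt_of_lt_of_le (by positivity) hmass) ((ENNReal.ofReal_le_ofReal hg).trans hmass)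
  have hz := hX.mass_le (x := ENNReal.ofReal (ρ / (1 + ρ ^ 2)))
    (z := ENNReal.ofReal (2 * (ρ / (1 + ρ ^ 2))))
    (by rw [← ENNReal.ofReal_one]; exact ENNReal.ofReal_le_ofReal (by linarith))
    (by
      rw [ENNReal.ofReal_mul (by norm_num), ENNReal.ofReal_ofNat, mul_comm, ← mul_assoc,
        ENNReal.inv_mul_cancel (by simp) (by simp), one_mul]) N
  have hle : ENNReal.ofReal (1 / 3) ≤
      coinSeq {x | ∃ n ≤ N, K ≤ (cutTimes (prefixWord x n)).card} + ENNReal.ofReal (1 / 6) := by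
    refine (hXmass.trans hz).trans ?_
    refine add_le_add (measure_mono ?_) ?_
    · rintro s ⟨n, hn, hs⟩
      exact ⟨n, hn, hXK _ hs⟩
    · rw [← ENNReal.ofReal_pow (by positivity)]
      exact ENNReal.ofReal_le_ofReal (by linarith)
  have h3 : ENNReal.ofReal (1 / 3) = ENNReal.ofReal (1 / 6) + ENNReal.ofReal (1 / 6) := by
    rw [← ENNReal.ofReal_add (by norm_num) (by norm_num)]
    norm_num
  rw [h3] at hle
  exact (ENNReal.add_le_add_iff_right ENNReal.ofReal_ne_top).mp hle

theorem le_coinSeq_many_cutTimes_log {H : ℕ} (hlog : 6 ≤ Real.log H)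
    (hH : 2 * Real.log H ^ 2 ≤ H) :
    ENNReal.ofReal (1 / 6) ≤ coinSeq {x | ∃ n ≤ 6 * H ^ 10,
      ⌊Real.log H ^ 2⌋₊ ≤ (cutTimes (prefixWord x n)).card} := by
  set L := Real.log H with hL
  set K := ⌊L ^ 2⌋₊ with hKdef
  have hK : (K : ℝ) ≤ L ^ 2 := Nat.floor_le (by positivity)
  have hHpos : 72 ≤ (H : ℝ) := by nlinarith
  have hH0 : 0 < (H : ℝ) := by linarith
  -- A success has mass at least `H ^ (-3) / 2`, while the killed mass `1 - ρ ^ (K * H)` is at most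
  -- `K * H * ε`, which is at most the same since `2 * K ≤ H`. The lifetime of the killed walk is of
  -- order `ε ^ (-2) = H ^ 10`, whence the horizon `6 * H ^ 10`.
  set ε := 1 / (H : ℝ) ^ 5 with hε
  have hε0 : 0 < ε := by positivity
  have hεH : ε * H ^ 5 = 1 := by rw [hε]; field_simp
  have hH1 : (1 : ℝ) ≤ H ^ 4 := one_le_pow₀ (by linarith)
  have hHε : H * ε ≤ 1 / 2 := by
    have h1 : (H : ℝ) * ε * H ^ 4 = 1 := by rw [← hεH]; ring
    have h2 : (2 : ℝ) ≤ H ^ 4 := by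
      calc (2 : ℝ) ≤ H ^ 1 := by linarith
        _ ≤ H ^ 4 := pow_le_pow_right₀ (by linarith) (by norm_num)
    nlinarith [mul_pos hH0 hε0]
  have hε1 : ε ≤ 1 / 2 := by nlinarith
  have hKH : ((K * H : ℕ) : ℝ) * ε ≤ 1 / (H : ℝ) ^ 3 / 2 := by
    have h1 : ((K * H : ℕ) : ℝ) * ε = K / (H : ℝ) ^ 4 := by
      rw [hε]; push_cast; field_simp
    rw [h1, div_div, div_le_div_iff₀ (by positivity) (by positivity), one_mul]
    calc (K : ℝ) * ((H : ℝ) ^ 3 * 2) = (2 * (K : ℝ)) * (H : ℝ) ^ 3 := by ring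
      _ ≤ (H : ℝ) * (H : ℝ) ^ 3 := by gcongr; linarith
      _ = (H : ℝ) ^ 4 := by ring
  have hpow : ∀ n : ℕ, 1 - n * ε ≤ (1 - ε) ^ n := by
    intro n
    have := one_add_mul_le_pow (a := -ε) (by linarith) n
    calc 1 - n * ε = 1 + n * -ε := by ring
      _ ≤ (1 + -ε) ^ n := this
      _ = (1 - ε) ^ n := by ring
  have hcube : 1 / (H : ℝ) ^ 3 ≤ 1 := by
    rw [div_le_one (by positivity)]
    exact one_le_pow₀ (by linarith)
  have hF : 1 / (H : ℝ) ^ 3 ≤ (1 - 1 / (L / 2)) ^ K := by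
    have hL0 : 0 < L := by linarith
    -- This uses `L ≥ 6`: the product `(1 - 2 / L) * (1 + 3 / L)` equals `1 + (L - 6) / L ^ 2`.
    have h1 : Real.exp (-(3 / L)) ≤ 1 - 1 / (L / 2) := by
      rw [Real.exp_neg, inv_le_iff_one_le_mul₀ (Real.exp_pos _)]
      have h2 : 1 / (L / 2) ≤ 1 / 3 := one_div_le_one_div_of_le (by norm_num) (by linarith)
      have h3 : 1 + 3 / L ≤ Real.exp (3 / L) := by linarith [Real.add_one_le_exp (3 / L)]
      calc (1 : ℝ) ≤ (1 - 1 / (L / 2)) * (1 + 3 / L) := by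
            have : (1 - 1 / (L / 2)) * (1 + 3 / L) = 1 + (L - 6) / L ^ 2 := by
              field_simp; ring
            rw [this]
            have : 0 ≤ (L - 6) / L ^ 2 := div_nonneg (by linarith) (by positivity)
            linarith
        _ ≤ _ := by
            gcongr
            linarith
    calc 1 / (H : ℝ) ^ 3 = Real.exp (-(3 * L)) := by
          rw [Real.exp_neg, one_div, show 3 * L = (3 : ℕ) * L by norm_num, Real.exp_nat_mul, hL,
            Real.exp_log hH0]
      _ ≤ Real.exp (K * -(3 / L)) := by
          refine Real.exp_le_exp.mpr ?_
          have : (K : ℝ) * (3 / L) ≤ L ^ 2 * (3 / L) := by gcongr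
          have h5 : L ^ 2 * (3 / L) = 3 * L := by field_simp
          linarith
      _ = Real.exp (-(3 / L)) ^ K := Real.exp_nat_mul _ _
      _ ≤ _ := by gcongr
  have hρM : 1 - ((K * H : ℕ) : ℝ) * ε ≤ (1 - ε) ^ (K * H) := hpow _
  refine le_coinSeq_many_cutTimes (ρ := 1 - ε) (H := H) (u := L / 2) (by linarith) (by linarith)
    (by linarith) ?_ ?_ ?_
  · have := hpow H
    rw [← hL]
    nlinarith
  · calc 1 - (1 - ε) ^ (K * H) ≤ 1 / (H : ℝ) ^ 3 * (1 / 2) := by linarith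
      _ ≤ _ := mul_le_mul hF (by linarith) (by norm_num) (le_trans (by positivity) hF)
  · have hz : 2 * ((1 - ε) / (1 + (1 - ε) ^ 2)) ≤ 1 - ε ^ 2 / 2 := by
      rw [mul_div_assoc', div_le_iff₀ (by positivity)]
      nlinarith [mul_nonneg hε0.le (sq_nonneg ε), mul_nonneg (sq_nonneg ε) (sq_nonneg ε)]
    have hz0 : 0 ≤ 2 * ((1 - ε) / (1 + (1 - ε) ^ 2)) := by
      have : 0 ≤ 1 - ε := by linarith
      positivity
    calc (2 * ((1 - ε) / (1 + (1 - ε) ^ 2))) ^ (6 * H ^ 10)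
        ≤ Real.exp (-(ε ^ 2 / 2)) ^ (6 * H ^ 10) := by
          gcongr
          exact hz.trans (Real.one_sub_le_exp_neg _)
      _ = Real.exp (-3) := by
          rw [← Real.exp_nat_mul]
          congr 1
          push_cast
          have : (6 * (H : ℝ) ^ 10) * -(ε ^ 2 / 2) = -3 * (ε * H ^ 5) ^ 2 := by ring
          rw [this, hεH]
          norm_num
      _ ≤ 1 / 8 := by
          rw [Real.exp_neg, ← one_div]
          refine one_div_le_one_div_of_le (by norm_num) ?_
          have h2 : (2 : ℝ) ≤ Real.exp 1 := by linarith [Real.add_one_le_exp (1 : ℝ)]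
          calc (8 : ℝ) = 2 ^ 3 := by norm_num
            _ ≤ Real.exp 1 ^ 3 := by gcongr
            _ = Real.exp 3 := by
              rw [← Real.exp_nat_mul]
              norm_num

/-- Continuity from above along the decreasing tail unions, each of measure at least `δ`. -/
theorem le_measure_frequently {α : Type*} [MeasurableSpace α] {μ : Measure α} [IsFiniteMeasure μ]
    {s : ℕ → Set α} (hs : ∀ n, MeasurableSet (s n)) {δ : ℝ≥0∞} (h : ∀ᶠ n in atTop, δ ≤ μ (s n)) :
    δ ≤ μ {x | ∃ᶠ n in atTop, x ∈ s n} := by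
  have hset : {x | ∃ᶠ n in atTop, x ∈ s n} = ⋂ n, ⋃ i ≥ n, s i := by
    ext x
    simp [frequently_atTop]
  rw [hset]
  refine ge_of_tendsto (tendsto_measure_iInter_atTop (fun n => ?_) ?_ ⟨0, measure_ne_top _ _⟩) ?_
  · exact (MeasurableSet.iUnion fun i => MeasurableSet.iUnion fun _ => hs i).nullMeasurableSet
  · intro m n hmn
    exact Set.iUnion₂_subset fun i hi => Set.subset_biUnion_of_mem (u := s) (hmn.trans hi)
  · filter_upwards [h] with n hn
    exact hn.trans (measure_mono fun x hx => Set.mem_iUnion₂.mpr ⟨n, le_rfl, hx⟩)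

theorem coinSeq_frequently_le_numRarelyVisitedEdges :
    0 < coinSeq {x | ∃ᶠ n : ℕ in atTop,
      1 / 128 * Real.log n ^ 2 ≤ numRarelyVisitedEdges (walk x) n} := by
  have hlogH : Tendsto (fun H : ℕ => Real.log H) atTop atTop :=
    Real.tendsto_log_atTop.comp tendsto_natCast_atTop_atTop
  have hlarge : ∀ᶠ H : ℕ in atTop, 6 ≤ Real.log H ∧ 2 * Real.log H ^ 2 ≤ H := by
    have h1 : (fun x : ℝ => Real.log x ^ 2) =o[atTop] fun x => x := by
      simpa using isLittleO_log_rpow_rpow_atTop (s := 1) 2 (by norm_num)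
    have h2 := tendsto_natCast_atTop_atTop.eventually (h1.bound (by norm_num : (0 : ℝ) < 1 / 2))
    filter_upwards [hlogH.eventually_ge_atTop 6, h2] with H h3 h4
    refine ⟨h3, ?_⟩
    rw [Real.norm_of_nonneg (by positivity), Real.norm_of_nonneg (by positivity)] at h4
    linarith
  refine lt_of_lt_of_le (b := ENNReal.ofReal (1 / 6)) (by simp) ?_
  refine (le_measure_frequently (s := fun H : ℕ => {x | ∃ n ≤ 6 * H ^ 10,
      ⌊Real.log H ^ 2⌋₊ ≤ (cutTimes (prefixWord x n)).card}) (fun H => ?_) ?_).trans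
    (measure_mono ?_)
  · have : {x | ∃ n ≤ 6 * H ^ 10, ⌊Real.log H ^ 2⌋₊ ≤ (cutTimes (prefixWord x n)).card} =
        ⋃ n ≤ 6 * H ^ 10, {x | prefixWord x n ∈ {w | ⌊Real.log H ^ 2⌋₊ ≤ (cutTimes w).card}} := by
      ext x
      simp
    rw [this]
    exact MeasurableSet.iUnion fun n => MeasurableSet.iUnion fun _ =>
      measurableSet_prefixWord_mem _ n
  · filter_upwards [hlarge] with H hH
    exact le_coinSeq_many_cutTimes_log hH.1 hH.2
  · intro x hx
    refine frequently_atTop.mpr fun n₀ => ?_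
    have hfloor : ∀ᶠ H : ℕ in atTop, n₀ < ⌊Real.log H ^ 2⌋₊ := by
      have : Tendsto (fun H : ℕ => ⌊Real.log H ^ 2⌋₊) atTop atTop :=
        tendsto_nat_floor_atTop.comp ((tendsto_pow_atTop (by norm_num)).comp hlogH)
      exact this.eventually_gt_atTop n₀
    obtain ⟨H, ⟨n, hnN, hn⟩, ⟨h6, -⟩, hK⟩ := (Frequently.and_eventually hx
      (hlarge.and hfloor)).exists
    -- The time `n` is only bounded above by the event, but it is at least the number of cut times,
    -- which exceeds `n₀`.
    have hcard : (cutTimes (prefixWord x n)).card ≤ n := by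
      simpa using card_cutTimes_le (prefixWord x n)
    refine ⟨n, by omega, ?_⟩
    have hnum : ((⌊Real.log H ^ 2⌋₊ : ℕ) : ℝ) ≤ numRarelyVisitedEdges (walk x) n := by
      exact_mod_cast hn.trans (card_cutTimes_le_numRarelyVisitedEdges x n)
    refine le_trans ?_ hnum
    have hfl := Nat.lt_floor_add_one (Real.log H ^ 2)
    have hlogn : Real.log n ≤ 10 * Real.log H + 2 := by
      have hn0 : (0 : ℝ) < n := by exact_mod_cast (by omega : 0 < n)
      have hH0 : (H : ℝ) ≠ 0 := by
        intro h
        rw [h, Real.log_zero] at h6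
        linarith
      have hlog6 : Real.log 6 ≤ 2 := by
        rw [Real.log_le_iff_le_exp (by norm_num)]
        have h2 : (2.7 : ℝ) ≤ Real.exp 1 := by linarith [Real.exp_one_gt_d9]
        calc (6 : ℝ) ≤ 2.7 ^ 2 := by norm_num
          _ ≤ Real.exp 1 ^ 2 := by gcongr
          _ = Real.exp 2 := by
            rw [← Real.exp_nat_mul]
            norm_num
      calc Real.log n ≤ Real.log (6 * (H : ℝ) ^ 10) :=
            Real.log_le_log hn0 (by exact_mod_cast hnN)
        _ = Real.log 6 + 10 * Real.log H := by
            rw [Real.log_mul (by norm_num) (by positivity), Real.log_pow]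
            norm_num
        _ ≤ _ := by linarith
    have hlogn0 := Real.log_natCast_nonneg n
    -- For `L = log H ≥ 6` one has `(10 * L + 2) ^ 2 / 128 ≤ L ^ 2 - 1`; the slack over `1 / 100`
    -- absorbs the constant 2 and the floor.
    nlinarith


/-! ### The zero-one law -/

/-- The normalized upper limit of the number of rarely visited edges. -/
noncomputable def rareLimsup (s : ℕ → ℤ) : EReal :=
  limsup (fun n : ℕ => (((numRarelyVisitedEdges s n : ℝ) / Real.log (n : ℝ) ^ 2 : ℝ) : EReal)) atTop

/-- Below any real `c` above the limsup of `v`, eventually `u n ≤ c * r n + e n`, which tends to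
`c`. Arguing in `EReal` avoids any boundedness assumption. -/
theorem limsup_coe_le_limsup_coe {u v r e : ℕ → ℝ} (hr0 : ∀ n, 0 ≤ r n)
    (hr : Tendsto r atTop (𝓝 1)) (he : Tendsto e atTop (𝓝 0))
    (h : ∀ᶠ n in atTop, u n ≤ v n * r n + e n) :
    limsup (fun n => (u n : EReal)) atTop ≤ limsup (fun n => (v n : EReal)) atTop := by
  by_contra hlt
  rw [not_le] at hlt
  obtain ⟨c, hc1, hc2⟩ := EReal.lt_iff_exists_real_btwn.mp hlt
  obtain ⟨d, hd1, hd2⟩ := EReal.lt_iff_exists_real_btwn.mp hc2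
  have hcd : c < d := EReal.coe_lt_coe_iff.mp hd1
  have hlim : Tendsto (fun n => c * r n + e n) atTop (𝓝 (c * 1 + 0)) := (hr.const_mul c).add he
  have hev := hlim.eventually_lt_const (u := d) (by linarith)
  refine absurd hd2 (not_lt.mpr (limsup_le_of_le (h := ?_)))
  filter_upwards [eventually_lt_of_limsup_lt hc1, hev, h] with n h1 h2 h3
  rw [EReal.coe_le_coe_iff]
  have h4 : v n * r n ≤ c * r n :=
    mul_le_mul_of_nonneg_right (EReal.coe_lt_coe_iff.mp h1).le (hr0 n)
  linarith

theorem tendsto_log_natCast : Tendsto (fun n : ℕ => Real.log n) atTop atTop :=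
  Real.tendsto_log_atTop.comp tendsto_natCast_atTop_atTop

theorem tendsto_one_div_log_sq : Tendsto (fun n : ℕ => 1 / Real.log n ^ 2) atTop (𝓝 0) := by
  simp only [one_div]
  exact tendsto_inv_atTop_zero.comp ((tendsto_pow_atTop (by norm_num)).comp tendsto_log_natCast)

theorem tendsto_log_succ_div_log_sq :
    Tendsto (fun n : ℕ => (Real.log (n + 1 : ℕ) / Real.log n) ^ 2) atTop (𝓝 1) := by
  have h1 : Tendsto (fun n : ℕ => 1 + (Real.log (n + 1) - Real.log n) * (Real.log n)⁻¹) atTop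
      (𝓝 (1 + 0 * 0)) :=
    (Real.tendsto_log_nat_add_one_sub_log.mul
      (tendsto_inv_atTop_zero.comp tendsto_log_natCast)).const_add 1
  have h2 : Tendsto (fun n : ℕ => Real.log (n + 1 : ℕ) / Real.log n) atTop (𝓝 1) := by
    refine Tendsto.congr' ?_ (by simpa using h1)
    filter_upwards [tendsto_log_natCast.eventually_gt_atTop 0] with n hn
    push_cast
    field_simp
    ring
  simpa using h2.pow 2

theorem rareLimsup_walk_shift (x : ℕ → Bool) :
    rareLimsup (walk fun i => x (i + 1)) = rareLimsup (walk x) := by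
  set a : ℕ → ℕ := numRarelyVisitedEdges (walk x) with ha
  set b : ℕ → ℕ := numRarelyVisitedEdges (walk fun i => x (i + 1)) with hb
  have hab : ∀ n, (a (n + 1) : ℝ) ≤ b n + 1 := fun n => by
    exact_mod_cast (numRarelyVisitedEdges_shift x n).1
  have hba : ∀ n, (b n : ℝ) ≤ a (n + 1) + 1 := fun n => by
    exact_mod_cast (numRarelyVisitedEdges_shift x n).2
  have hshift : rareLimsup (walk x) = limsup (fun n : ℕ =>
      (((a (n + 1) : ℝ) / Real.log (n + 1 : ℕ) ^ 2 : ℝ) : EReal)) atTop :=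
    (limsup_nat_add (fun n : ℕ => (((a n : ℝ) / Real.log (n : ℝ) ^ 2 : ℝ) : EReal)) 1).symm
  have hmono : ∀ n : ℕ, 0 < Real.log n → Real.log n ≤ Real.log (n + 1 : ℕ) := by
    intro n hn
    have : n ≠ 0 := by
      rintro rfl
      simp at hn
    exact Real.log_le_log (by positivity) (by push_cast; linarith)
  rw [hshift]
  refine le_antisymm ?_ ?_
  · refine limsup_coe_le_limsup_coe (fun n => sq_nonneg _)
      tendsto_log_succ_div_log_sq tendsto_one_div_log_sq ?_
    filter_upwards [tendsto_log_natCast.eventually_gt_atTop 0] with n hn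
    have h1 := hmono n hn
    have h2 : 0 < Real.log (n + 1 : ℕ) := hn.trans_le h1
    calc (b n : ℝ) / Real.log n ^ 2 ≤ (a (n + 1) + 1) / Real.log n ^ 2 := by
          gcongr
          exact hba n
      _ = _ := by field_simp
  · refine limsup_coe_le_limsup_coe (r := fun _ => 1) (fun n => zero_le_one) tendsto_const_nhds tendsto_one_div_log_sq ?_
    filter_upwards [tendsto_log_natCast.eventually_gt_atTop 0] with n hn
    have h1 := hmono n hn
    calc (a (n + 1) : ℝ) / Real.log (n + 1 : ℕ) ^ 2 ≤ (b n + 1) / Real.log n ^ 2 := by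
          gcongr
          exact hab n
      _ = _ := by rw [add_div, mul_one]

theorem rareLimsup_walk_shift_add (x : ℕ → Bool) (m : ℕ) :
    rareLimsup (walk fun i => x (i + m)) = rareLimsup (walk x) := by
  induction m with
  | zero => rfl
  | succ m ih =>
    rw [← ih, ← rareLimsup_walk_shift fun i => x (i + m)]
    congr 2
    ext i
    rw [add_right_comm, add_assoc]

theorem numRarelyVisitedEdges_congr {s t : ℕ → ℤ} {n : ℕ} (h : ∀ k ≤ n, s k = t k) :
    numRarelyVisitedEdges s n = numRarelyVisitedEdges t n := by
  have : ∀ y, edgeVisits s y n = edgeVisits t y n := by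
    intro y
    simp only [edgeVisits, upcrossings, downcrossings]
    congr 2 <;>
    · refine Finset.filter_congr fun k hk => ?_
      rw [Finset.mem_Ioc] at hk
      rw [h k hk.2, h (k - 1) (by omega)]
  simp only [numRarelyVisitedEdges, rarelyVisitedEdges, this]

theorem measurable_numRarelyVisitedEdges_walk (n : ℕ) :
    Measurable fun x => numRarelyVisitedEdges (walk x) n := by
  -- The count at time `n` depends only on the first `n` letters; the default `false` is never read
  -- up to that time.
  set f : List Bool → ℕ := fun w => numRarelyVisitedEdges (walk fun i => w.getD i false) n
  have hf : ∀ x, numRarelyVisitedEdges (walk x) n = f (prefixWord x n) := by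
    intro x
    refine numRarelyVisitedEdges_congr fun k hk => ?_
    simp only [walk, prefixWord]
    congr 1
    refine List.map_congr_left fun i hi => ?_
    have : i < n := by
      rw [List.mem_range] at hi
      omega
    simp [this]
  intro A _
  simp only [hf]
  exact measurableSet_prefixWord_mem (f ⁻¹' A) n

theorem measurable_rareLimsup_walk : Measurable fun x => rareLimsup (walk x) := by
  refine Measurable.limsup fun n => Measurable.coe_real_ereal ?_
  exact (measurable_from_nat.comp (measurable_numRarelyVisitedEdges_walk n)).div_const _

/-- Shift invariance writes `A` in terms of the coordinates from `m` on, for every `m`. So `A` is a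
tail event and Kolmogorov's law applies. -/
theorem coinSeq_eq_zero_or_one_of_shift {A : Set (ℕ → Bool)} (hA : MeasurableSet A)
    (hshift : ∀ m : ℕ, (fun (x : ℕ → Bool) i => x (i + m)) ⁻¹' A = A) :
    coinSeq A = 0 ∨ coinSeq A = 1 := by
  have hind : iIndep (fun n : ℕ => MeasurableSpace.comap (fun x : ℕ → Bool => x n) inferInstance)
      coinSeq := by
    have := iIndepFun_infinitePi (P := fun _ : ℕ => coin) (X := fun _ b => b)
      fun _ => measurable_id
    exact this
  refine measure_zero_or_one_of_measurableSet_limsup_atTop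
    (fun n => (measurable_pi_apply n).comap_le) hind ?_
  rw [limsup_eq_iInf_iSup_of_nat, MeasurableSpace.measurableSet_iInf]
  intro m
  rw [← hshift m]
  refine MeasurableSet.preimage hA ?_
  refine @measurable_pi_lambda _ _ _ (_) _ _ fun i => ?_
  refine Measurable.mono (comap_measurable fun x : ℕ → Bool => x (i + m)) ?_ le_rfl
  exact le_iSup₂_of_le (i + m) (Nat.le_add_left m i) le_rfl

/-- A function whose measurable preimages all have probability 0 or 1 is almost surely constant,
because countably many measurable sets separate the points of `EReal`. -/
theorem exists_ae_rareLimsup_walk_eq :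
    ∃ C : EReal, ∀ᵐ x ∂coinSeq, rareLimsup (walk x) = C := by
  refine exists_eventuallyEq_const_of_forall_separating (l := ae coinSeq)
    (f := fun x => rareLimsup (walk x)) MeasurableSet fun U hU => ?_
  have hA : MeasurableSet ((fun x => rareLimsup (walk x)) ⁻¹' U) := measurable_rareLimsup_walk hU
  rcases coinSeq_eq_zero_or_one_of_shift hA fun m => by
    ext x
    simp only [Set.mem_preimage, rareLimsup_walk_shift_add] with h | h
  · right
    exact measure_eq_zero_iff_ae_notMem.mp h
  · left
    exact (mem_ae_iff_prob_eq_one hA).mpr h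

theorem rareLimsup_le_of_eventually {s : ℕ → ℤ} {c : ℝ}
    (h : ∀ᶠ n : ℕ in atTop, (numRarelyVisitedEdges s n : ℝ) ≤ c * Real.log n ^ 2) :
    rareLimsup s ≤ c := by
  refine limsup_le_of_le (h := ?_)
  filter_upwards [h, tendsto_log_natCast.eventually_gt_atTop 0] with n h1 h2
  rw [EReal.coe_le_coe_iff, div_le_iff₀ (by positivity)]
  exact h1

theorem le_rareLimsup_of_frequently {s : ℕ → ℤ} {c : ℝ}
    (h : ∃ᶠ n : ℕ in atTop, c * Real.log n ^ 2 ≤ numRarelyVisitedEdges s n) :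
    (c : EReal) ≤ rareLimsup s := by
  refine le_limsup_of_frequently_le ?_
  refine (h.and_eventually (tendsto_log_natCast.eventually_gt_atTop 0)).mono ?_
  rintro n ⟨h1, h2⟩
  rw [EReal.coe_le_coe_iff, le_div_iff₀ (by positivity)]
  exact h1

theorem exists_ae_rareLimsup_walk_eq_coe :
    ∃ C : ℝ, C ∈ Set.Icc (1 / 128 : ℝ) (1 / 2) ∧
      ∀ᵐ x ∂coinSeq, rareLimsup (walk x) = (C : EReal) := by
  obtain ⟨C, hC⟩ := exists_ae_rareLimsup_walk_eq
  have hupper : ∀ c : ℝ, 1 / 2 < c → C ≤ c := by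
    intro c hc
    obtain ⟨x, h1, h2⟩ := (hC.and (ae_eventually_numRarelyVisitedEdges_le hc)).exists
    rw [← h1]
    exact rareLimsup_le_of_eventually h2
  have hlower : ((1 / 128 : ℝ) : EReal) ≤ C := by
    have hfreq := (frequently_ae_iff (μ := coinSeq) (p := fun x => ∃ᶠ n : ℕ in atTop,
      1 / 128 * Real.log n ^ 2 ≤ numRarelyVisitedEdges (walk x) n)).mpr
      coinSeq_frequently_le_numRarelyVisitedEdges.ne'
    obtain ⟨x, h1, h2⟩ := (hfreq.and_eventually hC).exists
    rw [← h2]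
    exact le_rareLimsup_of_frequently h1
  lift C to ℝ using
    ⟨ne_top_of_le_ne_top (EReal.coe_ne_top 1) (hupper 1 (by norm_num)),
      ne_bot_of_le_ne_bot (EReal.coe_ne_bot _) hlower⟩
  refine ⟨C, ⟨EReal.coe_le_coe_iff.mp hlower, ?_⟩, hC⟩
  exact le_of_forall_gt_imp_ge_of_dense fun c hc => EReal.coe_le_coe_iff.mp (hupper c hc)

/-! ### Transfer to an arbitrary simple random walk -/

/-- The sequence of steps of a path, encoded by letters. -/
def stepLetters (s : ℕ → ℤ) (n : ℕ) : Bool := decide (s (n + 1) - s n = 1)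

theorem eq_walk_stepLetters {s : ℕ → ℤ} (h0 : s 0 = 0)
    (h : ∀ n, s (n + 1) - s n = 1 ∨ s (n + 1) - s n = -1) : s = walk (stepLetters s) := by
  ext n
  induction n with
  | zero => simpa using h0
  | succ n ih =>
    rw [walk_succ, ← ih, stepLetters]
    rcases h n with h1 | h1 <;> simp [h1, stepValue] <;> omega

variable {Ω : Type*} [MeasurableSpace Ω] {P : Measure Ω} {S : ℕ → Ω → ℤ}

theorem IsSimpleSymmetricRandomWalk.measurable_step (hS : IsSimpleSymmetricRandomWalk P S)
    (n : ℕ) : Measurable fun ω => S (n + 1) ω - S n ω :=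
  (hS.measurable (n + 1)).sub (hS.measurable n)

theorem IsSimpleSymmetricRandomWalk.ae_eq_walk [IsProbabilityMeasure P]
    (hS : IsSimpleSymmetricRandomWalk P S) :
    ∀ᵐ ω ∂P, (fun m => S m ω) = walk (stepLetters fun m => S m ω) := by
  have hstep : ∀ n, ∀ᵐ ω ∂P, S (n + 1) ω - S n ω = 1 ∨ S (n + 1) ω - S n ω = -1 := by
    intro n
    have hm : ∀ c : ℤ, MeasurableSet {ω | S (n + 1) ω - S n ω = c} := fun c =>
      hS.measurable_step n (measurableSet_singleton c)
    have hd : Disjoint {ω | S (n + 1) ω - S n ω = 1} {ω | S (n + 1) ω - S n ω = -1} := by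
      refine Set.disjoint_left.mpr fun ω h1 h2 => ?_
      have h1' : S (n + 1) ω - S n ω = 1 := h1
      have h2' : S (n + 1) ω - S n ω = -1 := h2
      omega
    refine (mem_ae_iff_prob_eq_one ((hm 1).union (hm (-1)))).mpr ?_
    rw [measure_union hd (hm (-1)), hS.step_up, hS.step_down, ENNReal.add_halves]
  filter_upwards [hS.start, ae_all_iff.mpr hstep] with ω h0 h
  exact eq_walk_stepLetters h0 h

theorem IsSimpleSymmetricRandomWalk.measurable_stepLetters
    (hS : IsSimpleSymmetricRandomWalk P S) (n : ℕ) :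
    Measurable fun ω => stepLetters (fun m => S m ω) n :=
  (Measurable.of_discrete (f := fun d : ℤ => decide (d = 1))).comp (hS.measurable_step n)

theorem IsSimpleSymmetricRandomWalk.map_stepLetters [IsProbabilityMeasure P]
    (hS : IsSimpleSymmetricRandomWalk P S) :
    P.map (fun ω => stepLetters fun m => S m ω) = coinSeq := by
  have hind : iIndepFun (fun n ω => stepLetters (fun m => S m ω) n) P :=
    hS.indep.comp (fun _ d => decide (d = 1)) fun _ => Measurable.of_discrete
  have hmarg : ∀ n, P.map (fun ω => stepLetters (fun m => S m ω) n) = coin := by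
    intro n
    have := Measure.isProbabilityMeasure_map (μ := P) (hS.measurable_stepLetters n).aemeasurable
    have htrue : P.map (fun ω => stepLetters (fun m => S m ω) n) {true} = 2⁻¹ := by
      rw [Measure.map_apply (hS.measurable_stepLetters n) (measurableSet_singleton _)]
      have h := hS.step_up n
      rw [one_div] at h
      rw [← h]
      congr 1
      ext ω
      simp [stepLetters]
    refine Measure.ext_of_singleton fun b => ?_
    rw [coin_singleton]
    cases b with
    | true => exact htrue
    | false =>
      have hc : ({false} : Set Bool) = {true}ᶜ := by ext b; cases b <;> simp
      rw [hc, prob_compl_eq_one_sub (measurableSet_singleton _), htrue,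
        ENNReal.one_sub_inv_two]
  rw [hind.map_fun_eq_infinitePi_map hS.measurable_stepLetters, coinSeq]
  simp only [hmarg]

end RarelyVisited

theorem theorem3 :
    ∃ C : ℝ, C ∈ Set.Icc (1 / 128 : ℝ) (1 / 2) ∧
      ∀ (Ω : Type*) [MeasurableSpace Ω] (P : Measure Ω) [IsProbabilityMeasure P]
        (S : ℕ → Ω → ℤ), RarelyVisited.IsSimpleSymmetricRandomWalk P S →
        ∀ᵐ ω ∂P,
          Filter.limsup
            (fun n : ℕ =>
              (((RarelyVisited.numRarelyVisitedEdges (fun m => S m ω) n : ℝ)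
                / (Real.log (n : ℝ)) ^ 2 : ℝ) : EReal))
            Filter.atTop = (C : EReal) := by
  obtain ⟨C, hC, hlim⟩ := RarelyVisited.exists_ae_rareLimsup_walk_eq_coe
  refine ⟨C, hC, fun Ω _ P _ S hS => ?_⟩
  rw [← hS.map_stepLetters] at hlim
  filter_upwards [ae_of_ae_map (measurable_pi_lambda _ hS.measurable_stepLetters).aemeasurable hlim,
    hS.ae_eq_walk] with ω h1 h2
  rw [← h2] at h1
  exact h1
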